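/- **Infinite-horizon stochastic LQR with disturbance preview.** Consider the plant $x_{t+1}=Ax_t+B_uu_t+B_ww_t$, $t=0,1,2,\dots$, with $x_t\in\mathbb R^{n_x}$, $u_t\in\mathbb R^{n_u}$, $w_t\in\mathbb R^{n_w}$, where $A$ is nonsingular and $(A,B_u)$ is stabilizable, and weights $Q\succeq 0$, $R\succ 0$ with $(A,Q)$ detectable. The disturbance $(w_t)_{t\ge 0}$ is i.i.d. with $\mathbb E[w_i]=0$ and $\mathbb E[w_iw_j^\top]=\delta_{ij}I$; the initial condition $x_0$ is deterministic or, more generally, a random vector with finite second moment that is independent of $(w_t)_{t\ge0}$. Fix $p\ge 0$ and let $i_t=\{x_0,\dots,x_t,w_0,\dots,w_{t+p}\}$. A policy is a sequence $K=(K_0,K_1,\dots)$, where $K_t(\cdot\mid i_t)$ is a probability law on $\mathbb R^{n_u}$ from which $u_t$ is drawn: given $i_t$, the action $u_t$ has law $K_t(\cdot\mid i_t)$ and is independent of the past actions and of the remaining disturbances. A policy is deterministic if $u_t=k_t(i_t)$. It is stabilizing if $\sup_t\|\mathbb E[x_t]\|<\infty$ and $\sup_t\mathbb E\|x_t\|^2<\infty$.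 Its cost is $\mathbb E[J_\infty\mid i_0]\in[0,\infty]$, where $$J_\infty=\lim_{T\to\infty}\frac1T\sum_{t=0}^{T-1}\left(x_t^\top Qx_t+u_t^\top Ru_t\right),$$ with $\limsup$ in place of $\lim$ where the limit does not exist. Then there is a unique $P\succeq 0$ such that, with $H=R+B_u^\top PB_u$ and $K_x=H^{-1}B_u^\top PA$, $$0=P-A^\top PA-Q+A^\top PB_uH^{-1}B_u^\top PA\quad\text{and}\quad \hat A:=A-B_uK_x\text{ is Schur (spectral radius }<1).$$ Put $K_w=H^{-1}B_u^\top PB_w$, $K_v=H^{-1}B_u^\top$. The deterministic policy $$u_t=-K_xx_t-K_ww_t-K_vv_{t+1},\qquad v_{t+1}=\sum_{j=t+1}^{t+p}(\hat A^\top)^{j-t}PB_ww_j,$$ is stabilizing and optimal: under it the limit $J_\infty$ exists almost surely and is equal to $$J^*_{\infty,p}=\operatorname{trace}\left[PB_wB_w^\top\right]-\sum_{j=0}^{p}\operatorname{trace}\left[HK_v(\hat A^\top)^jPB_wB_w^\top P\hat A^jK_v^\top\right],$$ its cost is $\mathbb E[J_\infty\mid i_0]=J^*_{\infty,p}$ almost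 surely, and every stabilizing policy satisfies $\mathbb E[J_\infty\mid i_0]\ge J^*_{\infty,p}$ almost surely. In particular the optimal cost does not depend on the initial condition. -/

import Mathlib

open MeasureTheory ProbabilityTheory Filter Topology Matrix
open scoped ENNReal

namespace PreviewLQR

noncomputable section

/-! ### Linear systems -/

/-- A real square matrix is Schur if its spectral radius (over the complex numbers) is `< 1`. -/
def IsSchur {n : ℕ} (M : Matrix (Fin n) (Fin n) ℝ) : Prop :=
  spectralRadius ℂ (M.map (algebraMap ℝ ℂ)) < 1

/-- `(A, B)` is stabilizable: some state feedback makes the closed loop Schur. -/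
def Stabilizable {n m : ℕ} (A : Matrix (Fin n) (Fin n) ℝ) (B : Matrix (Fin n) (Fin m) ℝ) : Prop :=
  ∃ F : Matrix (Fin m) (Fin n) ℝ, IsSchur (A - B * F)

/-- `(A, C)` is detectable: some output injection makes the error dynamics Schur. -/
def Detectable {n k : ℕ} (A : Matrix (Fin n) (Fin n) ℝ) (C : Matrix (Fin k) (Fin n) ℝ) : Prop :=
  ∃ L : Matrix (Fin n) (Fin k) ℝ, IsSchur (A - L * C)

/-- The matrices of the plant `x_{t+1} = A x_t + B_u u_t + B_w w_t` and of the per-step cost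
`xᵀ Q x + uᵀ R u`. -/
structure LQRData (nx nu nw : ℕ) where
  A : Matrix (Fin nx) (Fin nx) ℝ
  Bu : Matrix (Fin nx) (Fin nu) ℝ
  Bw : Matrix (Fin nx) (Fin nw) ℝ
  Q : Matrix (Fin nx) (Fin nx) ℝ
  R : Matrix (Fin nu) (Fin nu) ℝ

namespace LQRData

variable {nx nu nw : ℕ} (S : LQRData nx nu nw) (P : Matrix (Fin nx) (Fin nx) ℝ)

/-- `H = R + B_uᵀ P B_u`. -/
def H : Matrix (Fin nu) (Fin nu) ℝ := S.R + S.Buᵀ * P * S.Bu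

/-- `K_x = H⁻¹ B_uᵀ P A`. -/
def Kx : Matrix (Fin nu) (Fin nx) ℝ := (S.H P)⁻¹ * S.Buᵀ * P * S.A

/-- `K_w = H⁻¹ B_uᵀ P B_w`. -/
def Kw : Matrix (Fin nu) (Fin nw) ℝ := (S.H P)⁻¹ * S.Buᵀ * P * S.Bw

/-- `K_v = H⁻¹ B_uᵀ`. -/
def Kv : Matrix (Fin nu) (Fin nx) ℝ := (S.H P)⁻¹ * S.Buᵀ

/-- The closed-loop matrix `Â = A - B_u K_x`. -/
def Ahat : Matrix (Fin nx) (Fin nx) ℝ := S.A - S.Bu * S.Kx P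

/-- `P` is a stabilizing solution of the discrete-time algebraic Riccati equation. -/
structure IsStabilizingSolution : Prop where
  posSemidef : P.PosSemidef
  dare : P - S.Aᵀ * P * S.A - S.Q + S.Aᵀ * P * S.Bu * (S.H P)⁻¹ * S.Buᵀ * P * S.A = 0
  schur : IsSchur (S.Ahat P)

/-- `trace[P B_w B_wᵀ] - ∑_{j=0}^p trace[H K_v (Âᵀ)^j P B_w B_wᵀ P Â^j K_vᵀ]`. -/
def optimalValue (p : ℕ) : ℝ :=
  trace (P * S.Bw * S.Bwᵀ) -
    ∑ j ∈ Finset.range (p + 1),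
      trace (S.H P * S.Kv P * (S.Ahat P)ᵀ ^ j * P * S.Bw * S.Bwᵀ * P * S.Ahat P ^ j * (S.Kv P)ᵀ)

/-- The per-step cost `xᵀ Q x + uᵀ R u`. -/
def stageCost (x : Fin nx → ℝ) (u : Fin nu → ℝ) : ℝ :=
  x ⬝ᵥ (S.Q *ᵥ x) + u ⬝ᵥ (S.R *ᵥ u)

end LQRData

/-! ### Information and policies -/

/-- The values of `i_t = {x_0, …, x_t, w_0, …, w_{t+p}}`. -/
abbrev Info (nx nw p t : ℕ) : Type :=
  (Fin (t + 1) → Fin nx → ℝ) × (Fin (t + p + 1) → Fin nw → ℝ)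

/-- A sequence of (possibly random) policies with `p` steps of preview: for each `t`, a probability
law of the action `u_t` for each value of the information `i_t`. -/
structure Policy (nx nu nw p : ℕ) where
  kernel : ∀ t : ℕ, Kernel (Info nx nw p t) (Fin nu → ℝ)
  isMarkov : ∀ t : ℕ, IsMarkovKernel (kernel t)

/-- The deterministic policy `u_t = k_t(i_t)`. -/
def Policy.deterministic {nx nu nw p : ℕ} (k : ∀ t : ℕ, Info nx nw p t → Fin nu → ℝ)
    (hk : ∀ t, Measurable (k t)) : Policy nx nu nw p where
  kernel t := Kernel.deterministic (k t) (hk t)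
  isMarkov _ := inferInstance

section Preview

variable {nx nu nw : ℕ} (S : LQRData nx nu nw) (P : Matrix (Fin nx) (Fin nx) ℝ) (p : ℕ)

/-- `v_{t+1} = ∑_{j=t+1}^{t+p} (Âᵀ)^{j-t} P B_w w_j`, a function of `i_t`. -/
def previewTerm (t : ℕ) (i : Info nx nw p t) : Fin nx → ℝ :=
  ∑ j ∈ Finset.univ.filter (fun j : Fin (t + p + 1) => t < (j : ℕ)),
    ((S.Ahat P)ᵀ ^ ((j : ℕ) - t) * P * S.Bw) *ᵥ i.2 j

/-- The control law `u_t = - K_x x_t - K_w w_t - K_v v_{t+1}`, a function of `i_t`. -/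
def previewLaw (t : ℕ) (i : Info nx nw p t) : Fin nu → ℝ :=
  - (S.Kx P *ᵥ i.1 (Fin.last t)) - S.Kw P *ᵥ i.2 ⟨t, by omega⟩
    - S.Kv P *ᵥ previewTerm S P p t i

theorem measurable_previewLaw (t : ℕ) : Measurable (previewLaw S P p t) := by
  refine Continuous.measurable ?_
  unfold previewLaw previewTerm
  fun_prop

/-- The deterministic policy given by `previewLaw`. -/
def previewPolicy : Policy nx nu nw p :=
  Policy.deterministic (previewLaw S P p) (measurable_previewLaw S P p)

end Preview

/-! ### Stochastic processes -/

section Stochastic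

variable {Ω : Type*} [MeasurableSpace Ω] {nx nu nw : ℕ}

/-- The disturbance: i.i.d., square integrable, `E[w_i] = 0` and `E[w_i w_jᵀ] = δ_{ij} I`. -/
structure IsNoise (μ : Measure Ω) (w : ℕ → Ω → Fin nw → ℝ) : Prop where
  measurable : ∀ t, Measurable (w t)
  indep : iIndepFun w μ
  identDistrib : ∀ s t, IdentDistrib (w s) (w t) μ μ
  memLp : ∀ t, MemLp (w t) 2 μ
  mean : ∀ t, ∫ ω, w t ω ∂μ = 0
  covariance : ∀ (i j : ℕ) (a b : Fin nw),
    ∫ ω, w i ω a * w j ω b ∂μ = if i = j ∧ a = b then 1 else 0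

/-- The initial condition: a square integrable random vector independent of the disturbance
(in particular, any deterministic vector). -/
structure IsInitial (μ : Measure Ω) (w : ℕ → Ω → Fin nw → ℝ) (x₀ : Ω → Fin nx → ℝ) : Prop where
  measurable : Measurable x₀
  memLp : MemLp x₀ 2 μ
  indep : IndepFun x₀ (fun ω t => w t ω) μ

/-- The realized information `i_t` along the trajectories `x`, `w`. -/
def info (p : ℕ) (x : ℕ → Ω → Fin nx → ℝ) (w : ℕ → Ω → Fin nw → ℝ) (t : ℕ) (ω : Ω) :
    Info nx nw p t :=
  (fun s => x s ω, fun s => w s ω)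

/-- Everything that is generated before the action `u_t` is drawn: the states up to time `t`, the
whole disturbance sequence (also its future), and the past actions. -/
abbrev History (nx nu nw t : ℕ) : Type :=
  (Fin (t + 1) → Fin nx → ℝ) × (ℕ → Fin nw → ℝ) × (Fin t → Fin nu → ℝ)

/-- The realized history. -/
def history (x : ℕ → Ω → Fin nx → ℝ) (w : ℕ → Ω → Fin nw → ℝ) (u : ℕ → Ω → Fin nu → ℝ) (t : ℕ)
    (ω : Ω) : History nx nu nw t :=
  (fun s => x s ω, fun s => w s ω, fun s => u s ω)

/-- The information `i_t` as a part of the history. -/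
def infoOfHistory (nx nu nw p t : ℕ) (h : History nx nu nw t) : Info nx nw p t :=
  (h.1, fun s => h.2.1 s)

theorem measurable_infoOfHistory (nx nu nw p t : ℕ) :
    Measurable (infoOfHistory nx nu nw p t) := by
  unfold infoOfHistory
  fun_prop

/-- The processes `x`, `u` are the closed loop of the plant with the policy `K`, the disturbance `w`
and the initial condition `x₀`: the plant equation holds, and, at each `t`, the action `u_t` is drawn
from the law `K_t(· | i_t)`, freshly given everything else (including future disturbances). -/
structure IsClosedLoop (S : LQRData nx nu nw) {p : ℕ} (K : Policy nx nu nw p) (μ : Measure Ω)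
    (w : ℕ → Ω → Fin nw → ℝ) (x₀ : Ω → Fin nx → ℝ)
    (x : ℕ → Ω → Fin nx → ℝ) (u : ℕ → Ω → Fin nu → ℝ) : Prop where
  measurable_u : ∀ t, Measurable (u t)
  init : x 0 = x₀
  step : ∀ t ω, x (t + 1) ω = S.A *ᵥ x t ω + S.Bu *ᵥ u t ω + S.Bw *ᵥ w t ω
  law : ∀ t, HasCondDistrib (u t) (history x w u t)
    ((K.kernel t).comap (infoOfHistory nx nu nw p t) (measurable_infoOfHistory nx nu nw p t)) μ

/-- The closed loop is stable: the state is uniformly bounded in mean and in second moment. -/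
def IsStabilized (μ : Measure Ω) (x : ℕ → Ω → Fin nx → ℝ) : Prop :=
  ∃ C : ℝ, ∀ t, MemLp (x t) 2 μ ∧ ‖∫ ω, x t ω ∂μ‖ ≤ C ∧ ∫ ω, x t ω ⬝ᵥ x t ω ∂μ ≤ C

/-- `(1/T) ∑_{t<T} (x_tᵀ Q x_t + u_tᵀ R u_t)` along one trajectory. -/
def averageCost (S : LQRData nx nu nw) (x : ℕ → Ω → Fin nx → ℝ) (u : ℕ → Ω → Fin nu → ℝ)
    (T : ℕ) (ω : Ω) : ℝ :=
  (1 / (T : ℝ)) * ∑ t ∈ Finset.range T, S.stageCost (x t ω) (u t ω)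

/-- The infinite-horizon average cost along one trajectory, in `[0, ∞]`. It is defined as an upper
limit, so that it makes sense for every policy; it is the limit wherever the limit exists. -/
def costInf (S : LQRData nx nu nw) (x : ℕ → Ω → Fin nx → ℝ) (u : ℕ → Ω → Fin nu → ℝ)
    (ω : Ω) : ℝ≥0∞ :=
  limsup (fun T => ENNReal.ofReal (averageCost S x u T ω)) atTop

/-- The conditional expectation `E[J_∞ | i_0]` with `i_0 = {x_0, w_0, …, w_p}`. -/
def expectedCost (S : LQRData nx nu nw) (p : ℕ) (μ : Measure Ω) (w : ℕ → Ω → Fin nw → ℝ)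
    (x : ℕ → Ω → Fin nx → ℝ) (u : ℕ → Ω → Fin nu → ℝ) : Ω → ℝ≥0∞ :=
  condLExp (MeasurableSpace.comap (info p x w 0) inferInstance) μ (costInf S x u)

end Stochastic

end

end PreviewLQR

open PreviewLQR

namespace PreviewLQR

/-! ### Schur matrices -/

section Schur

attribute [local instance] Matrix.linftyOpNormedRing Matrix.linftyOpNormedAlgebra

theorem exists_norm_pow_le_of_spectralRadius_lt_one {n : ℕ} (M : Matrix (Fin n) (Fin n) ℂ)
    (h : spectralRadius ℂ M < 1) :
    ∃ c r : ℝ, 0 ≤ c ∧ 0 ≤ r ∧ r < 1 ∧ ∀ k : ℕ, ‖M ^ k‖ ≤ c * r ^ k := by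
  have : CompleteSpace (Matrix (Fin n) (Fin n) ℂ) := FiniteDimensional.complete ℂ _
  obtain ⟨r, hr, hr1⟩ := ENNReal.lt_iff_exists_nnreal_btwn.1 h
  have hr0 : 0 < r := by
    rcases eq_or_ne r 0 with rfl | hne
    · simp at hr
    · exact pos_iff_ne_zero.2 hne
  have hr1' : (r : ℝ) < 1 := by exact_mod_cast hr1
  have hr0' : (0 : ℝ) < r := by exact_mod_cast hr0
  have hev := (spectrum.pow_nnnorm_pow_one_div_tendsto_nhds_spectralRadius M).eventually_lt_const hr
  obtain ⟨N, hN⟩ := eventually_atTop.1 hev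
  have hN' : ∀ k, max N 1 ≤ k → ‖M ^ k‖ ≤ (r : ℝ) ^ k := by
    intro k hk
    have hk1 : 1 ≤ k := (le_max_right _ _).trans hk
    have h1 := (hN k ((le_max_left _ _).trans hk)).le
    have h2 := ENNReal.rpow_le_rpow h1 (z := (k : ℝ)) (by positivity)
    rw [← ENNReal.rpow_mul, one_div, inv_mul_cancel₀ (by positivity), ENNReal.rpow_one,
      ENNReal.rpow_natCast] at h2
    exact_mod_cast h2
  refine ⟨∑ j ∈ Finset.range (max N 1), ‖M ^ j‖ / (r : ℝ) ^ j + 1, r, ?_, hr0'.le, hr1', ?_⟩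
  · positivity
  · intro k
    by_cases hk : k < max N 1
    · have := Finset.single_le_sum (f := fun j => ‖M ^ j‖ / (r : ℝ) ^ j)
        (fun j _ => by positivity) (Finset.mem_range.2 hk)
      have h3 : ‖M ^ k‖ / (r : ℝ) ^ k ≤
        ∑ j ∈ Finset.range (max N 1), ‖M ^ j‖ / (r : ℝ) ^ j + 1 := by
        linarith
      rwa [div_le_iff₀ (by positivity)] at h3
    · have h4 : (0 : ℝ) ≤ ∑ j ∈ Finset.range (max N 1), ‖M ^ j‖ / (r : ℝ) ^ j := by positivity
      have h5 := hN' k (not_lt.1 hk)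
      have h6 : (0 : ℝ) ≤ (r : ℝ) ^ k := by positivity
      nlinarith

theorem IsSchur.exists_pow_mulVec_le {n : ℕ} {M : Matrix (Fin n) (Fin n) ℝ} (h : IsSchur M) :
    ∃ c r : ℝ, 0 ≤ c ∧ 0 ≤ r ∧ r < 1 ∧
      ∀ (k : ℕ) (x : Fin n → ℝ), ‖M ^ k *ᵥ x‖ ≤ c * r ^ k * ‖x‖ := by
  obtain ⟨c, r, hc, hr, hr1, hk⟩ := exists_norm_pow_le_of_spectralRadius_lt_one _ h
  refine ⟨c, r, hc, hr, hr1, fun k x => ?_⟩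
  have hnorm : ∀ y : Fin n → ℝ, ‖(fun i => (y i : ℂ))‖ = ‖y‖ := by
    intro y
    simp [Pi.norm_def]
  have h1 : (fun i => ((M ^ k *ᵥ x) i : ℂ)) =
      (M.map (algebraMap ℝ ℂ)) ^ k *ᵥ (fun i => (x i : ℂ)) := by
    have h2 : (M.map (algebraMap ℝ ℂ)) ^ k = (M ^ k).map (algebraMap ℝ ℂ) :=
      (map_pow (algebraMap ℝ ℂ).mapMatrix M k).symm
    rw [h2]
    ext i
    simp [mulVec, dotProduct]
  rw [← hnorm, h1, ← hnorm x]
  exact (linfty_opNorm_mulVec _ _).trans (mul_le_mul_of_nonneg_right (hk k) (norm_nonneg _))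

theorem IsSchur.norm_lt_one_of_mulVec_eq {n : ℕ} {M : Matrix (Fin n) (Fin n) ℝ} (h : IsSchur M)
    {l : ℂ} {v : Fin n → ℂ} (hv : v ≠ 0) (hl : M.map (algebraMap ℝ ℂ) *ᵥ v = l • v) : ‖l‖ < 1 := by
  have hmem : l ∈ spectrum ℂ (M.map (algebraMap ℝ ℂ)) := by
    rw [spectrum.mem_iff, Matrix.isUnit_iff_isUnit_det, isUnit_iff_ne_zero, not_not,
      ← exists_mulVec_eq_zero_iff]
    refine ⟨v, hv, ?_⟩
    rw [sub_mulVec, hl, Algebra.algebraMap_eq_smul_one, smul_mulVec, one_mulVec, sub_self]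
  have h1 : (‖l‖₊ : ℝ≥0∞) < 1 := lt_of_le_of_lt
    (le_iSup₂ (f := fun k (_ : k ∈ spectrum ℂ (M.map (algebraMap ℝ ℂ))) => (‖k‖₊ : ℝ≥0∞)) l hmem) h
  exact_mod_cast h1

theorem isSchur_of_forall_mulVec_eq {n : ℕ} {M : Matrix (Fin n) (Fin n) ℝ}
    (h : ∀ (l : ℂ) (v : Fin n → ℂ), v ≠ 0 → M.map (algebraMap ℝ ℂ) *ᵥ v = l • v → ‖l‖ < 1) :
    IsSchur M := by
  have hlt : ∀ l ∈ spectrum ℂ (M.map (algebraMap ℝ ℂ)), ‖l‖₊ < (1 : NNReal) := by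
    intro l hl
    rw [spectrum.mem_iff, Matrix.isUnit_iff_isUnit_det, isUnit_iff_ne_zero, not_not,
      ← exists_mulVec_eq_zero_iff] at hl
    obtain ⟨v, hv, hvl⟩ := hl
    rw [sub_mulVec, Algebra.algebraMap_eq_smul_one, smul_mulVec, one_mulVec, sub_eq_zero] at hvl
    have := h l v hv hvl.symm
    exact_mod_cast this
  have : CompleteSpace (Matrix (Fin n) (Fin n) ℂ) := FiniteDimensional.complete ℂ _
  unfold IsSchur
  rcases (spectrum ℂ (M.map (algebraMap ℝ ℂ))).eq_empty_or_nonempty with he | hne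
  · simp only [spectralRadius, he]
    simp
  · exact_mod_cast spectrum.spectralRadius_lt_of_forall_lt_of_nonempty hne hlt

end Schur

/-- A complex eigenvector equation of a real matrix in terms of real and imaginary parts. -/
theorem map_mulVec_eq_smul_iff {n : ℕ} (M : Matrix (Fin n) (Fin n) ℝ) (l : ℂ) (v : Fin n → ℂ) :
    M.map (algebraMap ℝ ℂ) *ᵥ v = l • v ↔
      (M *ᵥ fun i => (v i).re) = (l.re • fun i => (v i).re) - (l.im • fun i => (v i).im) ∧
      (M *ᵥ fun i => (v i).im) = (l.im • fun i => (v i).re) + (l.re • fun i => (v i).im) := by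
  simp only [funext_iff, Complex.ext_iff, forall_and]
  refine and_congr (forall_congr' fun i => ?_) (forall_congr' fun i => ?_)
  · simp [mulVec, dotProduct, Complex.re_sum]
  · simp [mulVec, dotProduct, Complex.im_sum]
    constructor <;> intro h <;> linarith

/-! ### Quadratic forms -/

section Quadratic

variable {m n : ℕ}

theorem mulVec_dotProduct_eq (M : Matrix (Fin m) (Fin n) ℝ) (x : Fin n → ℝ) (y : Fin m → ℝ) :
    (M *ᵥ x) ⬝ᵥ y = x ⬝ᵥ (Mᵀ *ᵥ y) := by
  rw [dotProduct_transpose_mulVec, dotProduct_comm]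

theorem dotProduct_mulVec_comm {M : Matrix (Fin n) (Fin n) ℝ} (hM : Mᵀ = M) (x y : Fin n → ℝ) :
    x ⬝ᵥ (M *ᵥ y) = y ⬝ᵥ (M *ᵥ x) := by
  rw [dotProduct_comm, mulVec_dotProduct_eq, hM]

theorem PosSemidef.transpose_eq {M : Matrix (Fin n) (Fin n) ℝ} (h : M.PosSemidef) : Mᵀ = M := by
  simpa [IsHermitian] using h.isHermitian

theorem PosSemidef.dotProduct_nonneg {M : Matrix (Fin n) (Fin n) ℝ} (h : M.PosSemidef)
    (x : Fin n → ℝ) : 0 ≤ x ⬝ᵥ (M *ᵥ x) := by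
  simpa using h.dotProduct_mulVec_nonneg x

theorem posSemidef_of_dotProduct_nonneg {M : Matrix (Fin n) (Fin n) ℝ} (h : Mᵀ = M)
    (hx : ∀ x, 0 ≤ x ⬝ᵥ (M *ᵥ x)) : M.PosSemidef :=
  .of_dotProduct_mulVec_nonneg (by simpa [IsHermitian] using h) (by simpa using hx)

/-- Matrices converge if the quadratic forms of the (symmetric) matrices do. -/
theorem exists_tendsto_of_forall_tendsto_dotProduct {Ms : ℕ → Matrix (Fin n) (Fin n) ℝ}
    (hM : ∀ k, (Ms k)ᵀ = Ms k)
    (h : ∀ x : Fin n → ℝ, ∃ l, Tendsto (fun k => x ⬝ᵥ (Ms k *ᵥ x)) atTop (𝓝 l)) :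
    ∃ M : Matrix (Fin n) (Fin n) ℝ, Tendsto Ms atTop (𝓝 M) := by
  choose q hq using h
  refine ⟨Matrix.of fun i j => (q (Pi.single i 1 + Pi.single j 1) - q (Pi.single i 1) -
    q (Pi.single j 1)) / 2, ?_⟩
  refine tendsto_pi_nhds.2 fun i => tendsto_pi_nhds.2 fun j => ?_
  have h1 := (((hq (Pi.single i 1 + Pi.single j 1)).sub (hq (Pi.single i 1))).sub
    (hq (Pi.single j 1))).div_const 2
  refine h1.congr fun k => ?_
  simp only [mulVec_add, dotProduct_add, add_dotProduct]
  rw [dotProduct_mulVec_comm (hM k) (Pi.single j 1) (Pi.single i 1)]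
  simp
  ring

theorem isUnit_det_of_posDef {M : Matrix (Fin n) (Fin n) ℝ} (h : M.PosDef) : IsUnit M.det :=
  isUnit_iff_ne_zero.2 h.det_pos.ne'

/-- Completion of squares. -/
theorem complete_square {R : Matrix (Fin m) (Fin m) ℝ} {P : Matrix (Fin n) (Fin n) ℝ}
    {B : Matrix (Fin n) (Fin m) ℝ} {H : Matrix (Fin m) (Fin m) ℝ} (hH : H = R + Bᵀ * P * B)
    (hHt : Hᵀ = H) (hHu : IsUnit H.det) (hP : Pᵀ = P) (e z : Fin n → ℝ) (u : Fin m → ℝ) :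
    u ⬝ᵥ (R *ᵥ u) + (e + B *ᵥ u) ⬝ᵥ (P *ᵥ (e + B *ᵥ u)) + 2 * ((e + B *ᵥ u) ⬝ᵥ z) =
      (u + H⁻¹ *ᵥ (Bᵀ *ᵥ (P *ᵥ e + z))) ⬝ᵥ (H *ᵥ (u + H⁻¹ *ᵥ (Bᵀ *ᵥ (P *ᵥ e + z)))) +
      (e ⬝ᵥ (P *ᵥ e) + 2 * (e ⬝ᵥ z) -
        (Bᵀ *ᵥ (P *ᵥ e + z)) ⬝ᵥ (H⁻¹ *ᵥ (Bᵀ *ᵥ (P *ᵥ e + z)))) := by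
  set c := Bᵀ *ᵥ (P *ᵥ e + z) with hc
  have h1 : H *ᵥ (H⁻¹ *ᵥ c) = c := by
    rw [mulVec_mulVec, Matrix.mul_nonsing_inv _ hHu, one_mulVec]
  have h2 : u ⬝ᵥ c = (B *ᵥ u) ⬝ᵥ (P *ᵥ e) + (B *ᵥ u) ⬝ᵥ z := by
    rw [hc, ← mulVec_dotProduct_eq, dotProduct_add]
  have h3 : u ⬝ᵥ (H *ᵥ u) = u ⬝ᵥ (R *ᵥ u) + (B *ᵥ u) ⬝ᵥ (P *ᵥ (B *ᵥ u)) := by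
    rw [hH, add_mulVec, dotProduct_add, mulVec_dotProduct_eq, mulVec_mulVec, mulVec_mulVec,
      Matrix.mul_assoc]
  have h4 : (H⁻¹ *ᵥ c) ⬝ᵥ (H *ᵥ u) = u ⬝ᵥ c := by
    rw [dotProduct_mulVec_comm hHt, h1]
  have h5 : (H⁻¹ *ᵥ c) ⬝ᵥ c = c ⬝ᵥ (H⁻¹ *ᵥ c) := dotProduct_comm _ _
  simp only [mulVec_add, dotProduct_add, add_dotProduct, h1, h3, h4, h5]
  rw [dotProduct_mulVec_comm hP e (B *ᵥ u)]
  linarith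

end Quadratic

/-! ### The Riccati equation -/

namespace LQRData

variable {nx nu nw : ℕ} (S : LQRData nx nu nw) {P : Matrix (Fin nx) (Fin nx) ℝ}

/-- The right-hand side of the Riccati recursion. -/
noncomputable def riccati (P : Matrix (Fin nx) (Fin nx) ℝ) : Matrix (Fin nx) (Fin nx) ℝ :=
  S.Aᵀ * P * S.A + S.Q - S.Aᵀ * P * S.Bu * (S.H P)⁻¹ * S.Buᵀ * P * S.A

theorem riccati_eq_self_iff : S.riccati P = P ↔
    P - S.Aᵀ * P * S.A - S.Q + S.Aᵀ * P * S.Bu * (S.H P)⁻¹ * S.Buᵀ * P * S.A = 0 := by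
  unfold riccati
  rw [← sub_eq_zero, ← neg_eq_zero]
  constructor <;> intro h <;> rw [← h] <;> abel

variable {S}

theorem posDef_H (hR : S.R.PosDef) (hP : P.PosSemidef) : (S.H P).PosDef := by
  unfold H
  simpa using hR.add_posSemidef (hP.conjTranspose_mul_mul_same S.Bu)

theorem transpose_H (hR : S.R.PosDef) (hP : P.PosSemidef) : (S.H P)ᵀ = S.H P :=
  PosSemidef.transpose_eq (posDef_H hR hP).posSemidef

theorem isUnit_det_H (hR : S.R.PosDef) (hP : P.PosSemidef) : IsUnit (S.H P).det :=
  isUnit_det_of_posDef (posDef_H hR hP)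

theorem transpose_riccati (hQ : S.Q.PosSemidef) (hR : S.R.PosDef) (hP : P.PosSemidef) :
    (S.riccati P)ᵀ = S.riccati P := by
  unfold riccati
  simp only [transpose_sub, transpose_add, transpose_mul, transpose_transpose,
    transpose_nonsing_inv, transpose_H hR hP, PosSemidef.transpose_eq hP,
    PosSemidef.transpose_eq hQ, Matrix.mul_assoc]

/-- One step of dynamic programming. -/
theorem stageCost_add_eq (hR : S.R.PosDef) (hP : P.PosSemidef) (x : Fin nx → ℝ) (u : Fin nu → ℝ) :
    S.stageCost x u + (S.A *ᵥ x + S.Bu *ᵥ u) ⬝ᵥ (P *ᵥ (S.A *ᵥ x + S.Bu *ᵥ u)) =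
      (u + S.Kx P *ᵥ x) ⬝ᵥ (S.H P *ᵥ (u + S.Kx P *ᵥ x)) + x ⬝ᵥ (S.riccati P *ᵥ x) := by
  have hPt := PosSemidef.transpose_eq hP
  have h := complete_square (R := S.R) (P := P) (B := S.Bu) (H := S.H P) rfl (transpose_H hR hP)
    (isUnit_det_H hR hP) hPt (S.A *ᵥ x) 0 u
  have h1 : (S.H P)⁻¹ *ᵥ (S.Buᵀ *ᵥ (P *ᵥ (S.A *ᵥ x))) = S.Kx P *ᵥ x := by
    simp only [Kx, mulVec_mulVec, Matrix.mul_assoc]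
  have h2 : (S.Buᵀ *ᵥ (P *ᵥ (S.A *ᵥ x))) ⬝ᵥ (S.Kx P *ᵥ x) =
      x ⬝ᵥ ((S.Aᵀ * P * S.Bu * (S.H P)⁻¹ * S.Buᵀ * P * S.A) *ᵥ x) := by
    rw [← h1]
    simp only [mulVec_dotProduct_eq, mulVec_mulVec, transpose_mul, transpose_transpose, hPt,
      Matrix.mul_assoc]
  have h3 : (S.A *ᵥ x) ⬝ᵥ (P *ᵥ (S.A *ᵥ x)) = x ⬝ᵥ ((S.Aᵀ * P * S.A) *ᵥ x) := by
    simp only [mulVec_dotProduct_eq, mulVec_mulVec, Matrix.mul_assoc]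
  simp only [add_zero, dotProduct_zero, mul_zero, h1, h2, h3] at h
  simp only [stageCost, riccati, add_mulVec, sub_mulVec, dotProduct_add, dotProduct_sub] at h ⊢
  linarith

theorem dotProduct_riccati_le (hR : S.R.PosDef) (hP : P.PosSemidef) (x : Fin nx → ℝ)
    (u : Fin nu → ℝ) : x ⬝ᵥ (S.riccati P *ᵥ x) ≤
      S.stageCost x u + (S.A *ᵥ x + S.Bu *ᵥ u) ⬝ᵥ (P *ᵥ (S.A *ᵥ x + S.Bu *ᵥ u)) := by
  rw [stageCost_add_eq hR hP]
  have := PosSemidef.dotProduct_nonneg (posDef_H hR hP).posSemidef (u + S.Kx P *ᵥ x)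
  linarith

theorem dotProduct_riccati_eq (hR : S.R.PosDef) (hP : P.PosSemidef) (x : Fin nx → ℝ) :
    x ⬝ᵥ (S.riccati P *ᵥ x) = S.stageCost x (-(S.Kx P *ᵥ x)) +
      (S.A *ᵥ x + S.Bu *ᵥ (-(S.Kx P *ᵥ x))) ⬝ᵥ
        (P *ᵥ (S.A *ᵥ x + S.Bu *ᵥ (-(S.Kx P *ᵥ x)))) := by
  rw [stageCost_add_eq hR hP]
  simp

theorem stageCost_nonneg (hQ : S.Q.PosSemidef) (hR : S.R.PosDef) (x : Fin nx → ℝ)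
    (u : Fin nu → ℝ) : 0 ≤ S.stageCost x u :=
  add_nonneg (PosSemidef.dotProduct_nonneg hQ x) (PosSemidef.dotProduct_nonneg hR.posSemidef u)

theorem posSemidef_riccati (hQ : S.Q.PosSemidef) (hR : S.R.PosDef) (hP : P.PosSemidef) :
    (S.riccati P).PosSemidef := by
  refine posSemidef_of_dotProduct_nonneg (transpose_riccati hQ hR hP) fun x => ?_
  rw [dotProduct_riccati_eq hR hP]
  exact add_nonneg (stageCost_nonneg hQ hR _ _) (PosSemidef.dotProduct_nonneg hP _)

theorem dotProduct_riccati_mono {P' : Matrix (Fin nx) (Fin nx) ℝ} (hR : S.R.PosDef)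
    (hP : P.PosSemidef) (hP' : P'.PosSemidef) (h : ∀ x, x ⬝ᵥ (P *ᵥ x) ≤ x ⬝ᵥ (P' *ᵥ x))
    (x : Fin nx → ℝ) : x ⬝ᵥ (S.riccati P *ᵥ x) ≤ x ⬝ᵥ (S.riccati P' *ᵥ x) := by
  rw [dotProduct_riccati_eq hR hP' x]
  exact (dotProduct_riccati_le hR hP x _).trans (add_le_add_right (h _) _)

theorem continuousAt_riccati (hR : S.R.PosDef) (hP : P.PosSemidef) : ContinuousAt S.riccati P := by
  have hH : Continuous fun P => S.H P := by
    unfold H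
    fun_prop
  have hdet : (S.H P).det ≠ 0 := (isUnit_det_H hR hP).ne_zero
  have hinv : ContinuousAt (fun P => (S.H P)⁻¹) P := by
    have h1 : ContinuousAt (fun M : Matrix (Fin nu) (Fin nu) ℝ => M⁻¹) (S.H P) := by
      apply continuousAt_matrix_inv
      simpa [Ring.inverse_eq_inv'] using continuousAt_inv₀ hdet
    exact ContinuousAt.comp (f := fun P => S.H P) h1 hH.continuousAt
  unfold riccati
  fun_prop

theorem abs_dotProduct_mulVec_le {m n : ℕ} (M : Matrix (Fin m) (Fin n) ℝ) :
    ∃ c, 0 ≤ c ∧ ∀ (x : Fin m → ℝ) (y : Fin n → ℝ), |x ⬝ᵥ (M *ᵥ y)| ≤ c * (‖x‖ * ‖y‖) := by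
  refine ⟨∑ i, ∑ j, |M i j|, by positivity, fun x y => ?_⟩
  simp only [dotProduct, mulVec, Finset.mul_sum, Finset.sum_mul]
  refine (Finset.abs_sum_le_sum_abs _ _).trans (Finset.sum_le_sum fun i _ => ?_)
  refine (Finset.abs_sum_le_sum_abs _ _).trans (Finset.sum_le_sum fun j _ => ?_)
  rw [abs_mul, abs_mul]
  have h1 := norm_le_pi_norm x i
  have h2 := norm_le_pi_norm y j
  rw [Real.norm_eq_abs] at h1 h2
  calc |x i| * (|M i j| * |y j|) = |M i j| * (|x i| * |y j|) := by ring
    _ ≤ _ := by gcongr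

theorem exists_posSemidef_riccati_eq (hAB : Stabilizable S.A S.Bu) (hQ : S.Q.PosSemidef)
    (hR : S.R.PosDef) : ∃ P : Matrix (Fin nx) (Fin nx) ℝ, P.PosSemidef ∧ S.riccati P = P := by
  obtain ⟨F, hF⟩ := hAB
  set Ps : ℕ → Matrix (Fin nx) (Fin nx) ℝ := fun k => S.riccati^[k] 0 with hPs
  have hsucc : ∀ k, Ps (k + 1) = S.riccati (Ps k) := fun k =>
    Function.iterate_succ_apply' S.riccati k 0
  have hpsd : ∀ k, (Ps k).PosSemidef := by
    intro k
    induction k with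
    | zero => exact PosSemidef.zero
    | succ k ih => rw [hsucc]; exact posSemidef_riccati hQ hR ih
  have hmono : ∀ k x, x ⬝ᵥ (Ps k *ᵥ x) ≤ x ⬝ᵥ (Ps (k + 1) *ᵥ x) := by
    intro k
    induction k with
    | zero =>
      intro x
      have : Ps 0 = 0 := rfl
      rw [this]
      simpa using PosSemidef.dotProduct_nonneg (hpsd 1) x
    | succ k ih =>
      intro x
      rw [hsucc (k + 1), hsucc k]
      rw [hsucc k] at ih
      exact dotProduct_riccati_mono hR (hpsd k) (by rw [← hsucc]; exact hpsd (k + 1)) ih x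
  set M := S.A - S.Bu * F with hM
  set W := fun x : Fin nx → ℝ => S.stageCost x (-(F *ᵥ x)) with hW
  have hle : ∀ k x, x ⬝ᵥ (Ps k *ᵥ x) ≤ ∑ j ∈ Finset.range k, W (M ^ j *ᵥ x) := by
    intro k
    induction k with
    | zero => intro x; simp [hPs]
    | succ k ih =>
      intro x
      rw [hsucc]
      refine (dotProduct_riccati_le hR (hpsd k) x (-(F *ᵥ x))).trans ?_
      have h1 : S.A *ᵥ x + S.Bu *ᵥ (-(F *ᵥ x)) = M *ᵥ x := by
        rw [hM, sub_mulVec, mulVec_neg, mulVec_mulVec, sub_eq_add_neg]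
      rw [h1, Finset.sum_range_succ', add_comm]
      have h2 := ih (M *ᵥ x)
      simp only [mulVec_mulVec, ← pow_succ] at h2
      rw [pow_zero, one_mulVec]
      exact add_le_add_left (by simpa only [mulVec_mulVec] using h2) _
  obtain ⟨c, r, hc, hr, hr1, hpow⟩ := hF.exists_pow_mulVec_le
  obtain ⟨d, hd, hWd⟩ := abs_dotProduct_mulVec_le (S.Q + Fᵀ * S.R * F)
  have hWle : ∀ x, W x ≤ d * (‖x‖ * ‖x‖) := by
    intro x
    refine le_trans (le_of_eq ?_) ((le_abs_self _).trans (hWd x x))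
    simp only [hW, stageCost, add_mulVec, dotProduct_add, mulVec_neg, neg_dotProduct_neg,
      mulVec_dotProduct_eq, mulVec_mulVec, Matrix.mul_assoc]
  have hbdd : ∀ k x, x ⬝ᵥ (Ps k *ᵥ x) ≤ d * (c * ‖x‖) ^ 2 * (1 - r ^ 2)⁻¹ := by
    intro k x
    have hr2 : r ^ 2 < 1 := by nlinarith
    calc x ⬝ᵥ (Ps k *ᵥ x) ≤ ∑ j ∈ Finset.range k, W (M ^ j *ᵥ x) := hle k x
      _ ≤ ∑ j ∈ Finset.range k, d * (c * ‖x‖) ^ 2 * (r ^ 2) ^ j := by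
        refine Finset.sum_le_sum fun j _ => (hWle _).trans ?_
        have h1 := hpow j x
        have h2 : ‖M ^ j *ᵥ x‖ * ‖M ^ j *ᵥ x‖ ≤ (c * r ^ j * ‖x‖) * (c * r ^ j * ‖x‖) :=
          mul_self_le_mul_self (norm_nonneg _) h1
        calc d * (‖M ^ j *ᵥ x‖ * ‖M ^ j *ᵥ x‖) ≤ d * ((c * r ^ j * ‖x‖) * (c * r ^ j * ‖x‖)) := by
              gcongr
          _ = _ := by ring
      _ = d * (c * ‖x‖) ^ 2 * ∑ j ∈ Finset.range k, (r ^ 2) ^ j := by rw [Finset.mul_sum]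
      _ ≤ d * (c * ‖x‖) ^ 2 * (1 - r ^ 2)⁻¹ := by
        gcongr
        rw [← tsum_geometric_of_lt_one (by positivity) hr2]
        exact (summable_geometric_of_lt_one (by positivity) hr2).sum_le_tsum _
          fun _ _ => by positivity
  obtain ⟨P, hP⟩ := exists_tendsto_of_forall_tendsto_dotProduct
    (fun k => PosSemidef.transpose_eq (hpsd k)) (fun x => ⟨_, tendsto_atTop_ciSup
      (monotone_nat_of_le_succ fun k => hmono k x) ⟨_, by rintro _ ⟨k, rfl⟩; exact hbdd k x⟩⟩)
  have hPpsd : P.PosSemidef := by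
    refine posSemidef_of_dotProduct_nonneg ?_ fun x => ?_
    · refine tendsto_nhds_unique ?_ hP
      have h1 : Tendsto (fun k => (Ps k)ᵀ) atTop (𝓝 Pᵀ) :=
        (continuous_id.matrix_transpose.tendsto P).comp hP
      exact h1.congr fun k => PosSemidef.transpose_eq (hpsd k)
    · have h2 : Continuous fun P : Matrix (Fin nx) (Fin nx) ℝ => x ⬝ᵥ (P *ᵥ x) := by fun_prop
      exact ge_of_tendsto' ((h2.tendsto P).comp hP) fun k => PosSemidef.dotProduct_nonneg (hpsd k) x
  refine ⟨P, hPpsd, tendsto_nhds_unique ?_ ((tendsto_add_atTop_iff_nat 1).2 hP)⟩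
  exact ((continuousAt_riccati hR hPpsd).tendsto.comp hP).congr fun k => (hsucc k).symm

theorem isSchur_Ahat (hQ : S.Q.PosSemidef) (hR : S.R.PosDef) (hAQ : Detectable S.A S.Q)
    (hP : P.PosSemidef) (hric : S.riccati P = P) : IsSchur (S.Ahat P) := by
  obtain ⟨L, hL⟩ := hAQ
  refine isSchur_of_forall_mulVec_eq fun l v hv hl => ?_
  by_contra! hl1
  obtain ⟨ha, hb⟩ := (map_mulVec_eq_smul_iff _ _ _).1 hl
  set a : Fin nx → ℝ := fun i => (v i).re with hadef
  set b : Fin nx → ℝ := fun i => (v i).im with hbdef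
  have hid : ∀ x, x ⬝ᵥ (P *ᵥ x) = x ⬝ᵥ (S.Q *ᵥ x) + (S.Kx P *ᵥ x) ⬝ᵥ (S.R *ᵥ (S.Kx P *ᵥ x)) +
      (S.Ahat P *ᵥ x) ⬝ᵥ (P *ᵥ (S.Ahat P *ᵥ x)) := by
    intro x
    have h1 := dotProduct_riccati_eq hR hP x
    have h2 : S.A *ᵥ x + S.Bu *ᵥ (-(S.Kx P *ᵥ x)) = S.Ahat P *ᵥ x := by
      rw [Ahat, sub_mulVec, mulVec_neg, mulVec_mulVec, sub_eq_add_neg]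
    rw [hric, h2] at h1
    simpa [stageCost, mulVec_neg] using h1
  have hsq : 1 ≤ l.re ^ 2 + l.im ^ 2 := by
    have h1 : ‖l‖ ^ 2 = l.re ^ 2 + l.im ^ 2 := by
      rw [Complex.sq_norm, Complex.normSq_apply]; ring
    nlinarith
  have hsum : (S.Ahat P *ᵥ a) ⬝ᵥ (P *ᵥ (S.Ahat P *ᵥ a)) +
      (S.Ahat P *ᵥ b) ⬝ᵥ (P *ᵥ (S.Ahat P *ᵥ b)) =
      (l.re ^ 2 + l.im ^ 2) * (a ⬝ᵥ (P *ᵥ a) + b ⬝ᵥ (P *ᵥ b)) := by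
    rw [ha, hb]
    simp only [mulVec_add, mulVec_sub, mulVec_smul, dotProduct_add, dotProduct_sub, add_dotProduct,
      sub_dotProduct, smul_dotProduct, dotProduct_smul, smul_eq_mul]
    rw [dotProduct_mulVec_comm (PosSemidef.transpose_eq hP) b a]
    ring
  have hPa := PosSemidef.dotProduct_nonneg hP a
  have hPb := PosSemidef.dotProduct_nonneg hP b
  have hQa := PosSemidef.dotProduct_nonneg hQ a
  have hQb := PosSemidef.dotProduct_nonneg hQ b
  have hRa := PosSemidef.dotProduct_nonneg hR.posSemidef (S.Kx P *ᵥ a)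
  have hRb := PosSemidef.dotProduct_nonneg hR.posSemidef (S.Kx P *ᵥ b)
  have hida := hid a
  have hidb := hid b
  have hge : a ⬝ᵥ (P *ᵥ a) + b ⬝ᵥ (P *ᵥ b) ≤
      (l.re ^ 2 + l.im ^ 2) * (a ⬝ᵥ (P *ᵥ a) + b ⬝ᵥ (P *ᵥ b)) := by nlinarith
  have hzero : ∀ x, x ⬝ᵥ (S.Q *ᵥ x) = 0 → (S.Kx P *ᵥ x) ⬝ᵥ (S.R *ᵥ (S.Kx P *ᵥ x)) = 0 →
      (S.A - L * S.Q) *ᵥ x = S.Ahat P *ᵥ x := by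
    intro x hQx hRx
    have h1 : S.Q *ᵥ x = 0 := (hQ.dotProduct_mulVec_zero_iff x).1 (by simpa using hQx)
    have h2 : S.Kx P *ᵥ x = 0 := by
      by_contra hne
      have := hR.dotProduct_mulVec_pos hne
      simp only [star_trivial] at this
      linarith
    rw [Ahat, sub_mulVec, sub_mulVec, ← mulVec_mulVec, ← mulVec_mulVec, h1, h2]
    simp
  have hlt := hL.norm_lt_one_of_mulVec_eq hv ((map_mulVec_eq_smul_iff _ _ _).2
    ⟨(hzero a (by linarith) (by linarith)).trans ha, (hzero b (by linarith) (by linarith)).trans hb⟩)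
  linarith

theorem R_mul_Kx (hR : S.R.PosDef) (hP : P.PosSemidef) :
    S.Buᵀ * P * S.Ahat P = S.R * S.Kx P := by
  have h1 : S.H P * S.Kx P = S.Buᵀ * P * S.A := by
    rw [Kx, Matrix.mul_assoc, Matrix.mul_assoc, Matrix.mul_nonsing_inv_cancel_left _ _
      (isUnit_det_H hR hP), Matrix.mul_assoc]
  rw [Ahat, Matrix.mul_sub, ← h1, ← Matrix.mul_assoc, ← Matrix.sub_mul]
  simp [H]

theorem eq_transpose_mul_Ahat (hric : S.riccati P = P) : P = S.Aᵀ * P * S.Ahat P + S.Q := by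
  conv_lhs => rw [← hric]
  simp only [riccati, Ahat, Kx, Matrix.mul_sub, Matrix.mul_assoc]
  abel

theorem IsStabilizingSolution.riccati_eq (h : S.IsStabilizingSolution P) : S.riccati P = P :=
  S.riccati_eq_self_iff.2 h.dare

theorem IsStabilizingSolution.unique {P' : Matrix (Fin nx) (Fin nx) ℝ} (hQ : S.Q.PosSemidef)
    (hR : S.R.PosDef) (h : S.IsStabilizingSolution P) (h' : S.IsStabilizingSolution P') :
    P' = P := by
  have hP := PosSemidef.transpose_eq h.posSemidef
  have hP' := PosSemidef.transpose_eq h'.posSemidef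
  have h1 : P = (S.Ahat P)ᵀ * P * S.A + S.Q := by
    conv_lhs => rw [← hP, eq_transpose_mul_Ahat h.riccati_eq]
    simp only [transpose_add, transpose_mul, transpose_transpose, hP, PosSemidef.transpose_eq hQ,
      Matrix.mul_assoc]
  have h2 := eq_transpose_mul_Ahat h'.riccati_eq
  have h3 : (S.Ahat P)ᵀ * P * S.Bu = (S.Kx P)ᵀ * S.R := by
    have := congrArg transpose (R_mul_Kx hR h.posSemidef)
    simpa only [transpose_mul, transpose_transpose, hP, PosSemidef.transpose_eq hR.posSemidef,
      Matrix.mul_assoc] using this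
  have h4 := R_mul_Kx hR h'.posSemidef
  have hstep : P - P' = (S.Ahat P)ᵀ * (P - P') * S.Ahat P' := by
    have e1 : (S.Ahat P)ᵀ * P * S.Ahat P' =
        (S.Ahat P)ᵀ * P * S.A - (S.Kx P)ᵀ * S.R * S.Kx P' := by
      rw [show S.Ahat P' = S.A - S.Bu * S.Kx P' from rfl, Matrix.mul_sub, ← Matrix.mul_assoc, h3]
    have e2 : (S.Ahat P)ᵀ * P' * S.Ahat P' =
        S.Aᵀ * P' * S.Ahat P' - (S.Kx P)ᵀ * S.R * S.Kx P' := by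
      rw [show (S.Ahat P)ᵀ = S.Aᵀ - (S.Kx P)ᵀ * S.Buᵀ by rw [Ahat, transpose_sub, transpose_mul],
        Matrix.sub_mul, Matrix.sub_mul, Matrix.mul_assoc (S.Kx P)ᵀ S.R, ← h4]
      simp only [Matrix.mul_assoc]
    rw [Matrix.mul_sub, Matrix.sub_mul, e1, e2]
    conv_lhs => rw [h1, h2]
    abel
  have hiter : ∀ (k : ℕ) (x y : Fin nx → ℝ), x ⬝ᵥ ((P - P') *ᵥ y) =
      (S.Ahat P ^ k *ᵥ x) ⬝ᵥ ((P - P') *ᵥ (S.Ahat P' ^ k *ᵥ y)) := by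
    intro k
    induction k with
    | zero => simp
    | succ k ih =>
      intro x y
      rw [hstep, ← mulVec_mulVec, ← mulVec_mulVec, ← mulVec_dotProduct_eq, ih, mulVec_mulVec,
        mulVec_mulVec _ (S.Ahat P' ^ k), pow_succ, pow_succ, ← hstep]
  obtain ⟨c, r, hc, hr, hr1, hpow⟩ := h.schur.exists_pow_mulVec_le
  obtain ⟨c', r', hc', hr', hr1', hpow'⟩ := h'.schur.exists_pow_mulVec_le
  obtain ⟨d, hd, hd'⟩ := abs_dotProduct_mulVec_le (P - P')
  have hzero : ∀ x y : Fin nx → ℝ, x ⬝ᵥ ((P - P') *ᵥ y) = 0 := by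
    intro x y
    have hle : ∀ k : ℕ, |x ⬝ᵥ ((P - P') *ᵥ y)| ≤
        d * ((c * r ^ k * ‖x‖) * (c' * r' ^ k * ‖y‖)) := by
      intro k
      rw [hiter k x y]
      refine (hd' _ _).trans ?_
      gcongr
      · exact hpow k x
      · exact hpow' k y
    have hlim : Tendsto (fun k : ℕ => d * ((c * r ^ k * ‖x‖) * (c' * r' ^ k * ‖y‖))) atTop
        (𝓝 (d * ((c * 0 * ‖x‖) * (c' * 0 * ‖y‖)))) := by
      have t1 := tendsto_pow_atTop_nhds_zero_of_lt_one hr hr1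
      have t2 := tendsto_pow_atTop_nhds_zero_of_lt_one hr' hr1'
      exact (((t1.const_mul c).mul_const _).mul ((t2.const_mul c').mul_const _)).const_mul d
    have := ge_of_tendsto' hlim hle
    simpa using this
  have : P - P' = 0 := by
    ext i j
    simpa using hzero (Pi.single i 1) (Pi.single j 1)
  exact (sub_eq_zero.1 this).symm

theorem exists_isStabilizingSolution (hAB : Stabilizable S.A S.Bu) (hQ : S.Q.PosSemidef)
    (hR : S.R.PosDef) (hAQ : Detectable S.A S.Q) :
    ∃ P : Matrix (Fin nx) (Fin nx) ℝ, S.IsStabilizingSolution P := by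
  obtain ⟨P, hP, hric⟩ := exists_posSemidef_riccati_eq hAB hQ hR
  exact ⟨P, hP, S.riccati_eq_self_iff.1 hric, isSchur_Ahat hQ hR hAQ hP hric⟩

end LQRData

/-! ### The preview cost-to-go along one trajectory -/

namespace LQRData

variable {nx nu nw : ℕ} (S : LQRData nx nu nw) (P : Matrix (Fin nx) (Fin nx) ℝ) {p : ℕ}

/-- The weight `(Âᵀ)^j P B_w` of the disturbance that is `j` steps ahead. -/
noncomputable def previewWeight (j : ℕ) : Matrix (Fin nx) (Fin nw) ℝ := (S.Ahat P)ᵀ ^ j * P * S.Bw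

/-- The contribution of the window `b = (w_t, …, w_{t+p})` without `w_t` itself. -/
noncomputable def previewTail (b : Fin (p + 1) → Fin nw → ℝ) : Fin nx → ℝ :=
  ∑ j : Fin p, S.previewWeight P (j + 1) *ᵥ b j.succ

/-- The contribution of the window `b = (w_t, …, w_{t+p})`. -/
noncomputable def previewSum (b : Fin (p + 1) → Fin nw → ℝ) : Fin nx → ℝ :=
  ∑ j : Fin (p + 1), S.previewWeight P j *ᵥ b j

/-- The action of the preview law in the state `x` with the window `b = (w_t, …, w_{t+p})`. -/
noncomputable def previewAction (x : Fin nx → ℝ) (b : Fin (p + 1) → Fin nw → ℝ) : Fin nu → ℝ :=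
  -(S.Kx P *ᵥ x) - S.Kw P *ᵥ b 0 - S.Kv P *ᵥ S.previewTail P b

/-- The part of the cost of one step that depends on the window `b` only. -/
noncomputable def windowCost (b : Fin (p + 1) → Fin nw → ℝ) : ℝ :=
  b 0 ⬝ᵥ ((S.Bwᵀ * P * S.Bw) *ᵥ b 0) + 2 * ((S.Bw *ᵥ b 0) ⬝ᵥ S.previewTail P b) -
    (S.Kv P *ᵥ S.previewSum P b) ⬝ᵥ (S.H P *ᵥ (S.Kv P *ᵥ S.previewSum P b))

/-- The state-dependent part of the optimal cost-to-go. -/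
noncomputable def costToGo (x : Fin nx → ℝ) (b : Fin (p + 1) → Fin nw → ℝ) : ℝ :=
  x ⬝ᵥ (P *ᵥ x) + 2 * (x ⬝ᵥ ((S.Ahat P)ᵀ *ᵥ S.previewSum P b))

/-- The window `(w_t, …, w_{t+p})`. -/
def window {α : Type*} (p : ℕ) (w : ℕ → α) (t : ℕ) (j : Fin (p + 1)) : α := w (t + j)

variable {S P}

theorem previewSum_eq (b : Fin (p + 1) → Fin nw → ℝ) :
    S.previewSum P b = P *ᵥ (S.Bw *ᵥ b 0) + S.previewTail P b := by
  simp [previewSum, previewTail, Fin.sum_univ_succ, previewWeight]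

theorem Ahat_transpose_mulVec_previewSum (w : ℕ → Fin nw → ℝ) (t : ℕ) :
    (S.Ahat P)ᵀ *ᵥ S.previewSum P (window p w (t + 1)) =
      S.previewTail P (window p w t) + S.previewWeight P (p + 1) *ᵥ w (t + 1 + p) := by
  simp only [previewSum, previewTail, window, Fin.sum_univ_castSucc, mulVec_add, mulVec_sum, mulVec_mulVec,
    previewWeight, pow_succ', Matrix.mul_assoc, Fin.val_castSucc, Fin.val_last, Fin.val_succ]
  congr 1
  refine Finset.sum_congr rfl fun j _ => ?_
  rw [show t + 1 + (j : ℕ) = t + (j + 1) by ring]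

theorem stageCost_add_previewCost (hR : S.R.PosDef) (hP : P.PosSemidef) (hric : S.riccati P = P)
    (x : Fin nx → ℝ) (u : Fin nu → ℝ) (b : Fin (p + 1) → Fin nw → ℝ) (y : Fin nx → ℝ)
    (hy : y = S.A *ᵥ x + S.Bu *ᵥ u + S.Bw *ᵥ b 0) :
    S.stageCost x u + (y ⬝ᵥ (P *ᵥ y) + 2 * (y ⬝ᵥ S.previewTail P b)) =
      (u - S.previewAction P x b) ⬝ᵥ (S.H P *ᵥ (u - S.previewAction P x b)) +
        S.costToGo P x b + S.windowCost P b := by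
  have hPt := PosSemidef.transpose_eq hP
  have hHt := transpose_H hR hP
  have hHu := isUnit_det_H hR hP
  set v := S.previewTail P b with hv
  set s := S.previewSum P b with hs
  set d := S.Bw *ᵥ b 0 with hd
  have hsv : s = P *ᵥ d + v := previewSum_eq b
  have hHit : ((S.H P)⁻¹)ᵀ = (S.H P)⁻¹ := by rw [transpose_nonsing_inv, hHt]
  have h := complete_square (R := S.R) (P := P) (B := S.Bu) (H := S.H P) rfl hHt hHu hPt
    (S.A *ᵥ x + d) v u
  have hy' : S.A *ᵥ x + d + S.Bu *ᵥ u = y := by rw [hy]; abel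
  have hPe : P *ᵥ (S.A *ᵥ x + d) + v = P *ᵥ (S.A *ᵥ x) + s := by
    rw [hsv, mulVec_add, add_assoc]
  have hu : u + (S.H P)⁻¹ *ᵥ (S.Buᵀ *ᵥ (P *ᵥ (S.A *ᵥ x) + s)) = u - S.previewAction P x b := by
    rw [previewAction, ← hv, hsv, hd]
    simp only [Kx, Kw, Kv, mulVec_add, mulVec_mulVec, Matrix.mul_assoc]
    abel
  have hKv : ∀ z, S.H P *ᵥ (S.Kv P *ᵥ z) = S.Buᵀ *ᵥ z := by
    intro z
    rw [mulVec_mulVec, Kv, Matrix.mul_nonsing_inv_cancel_left _ _ hHu]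
  have hss : (S.Kv P *ᵥ s) ⬝ᵥ (S.H P *ᵥ (S.Kv P *ᵥ s)) =
      (S.Buᵀ *ᵥ s) ⬝ᵥ ((S.H P)⁻¹ *ᵥ (S.Buᵀ *ᵥ s)) := by
    rw [hKv, dotProduct_comm, Kv, mulVec_mulVec]
  have hxx : x ⬝ᵥ (P *ᵥ x) = (S.A *ᵥ x) ⬝ᵥ (P *ᵥ (S.A *ᵥ x)) + x ⬝ᵥ (S.Q *ᵥ x) -
      (S.Buᵀ *ᵥ (P *ᵥ (S.A *ᵥ x))) ⬝ᵥ ((S.H P)⁻¹ *ᵥ (S.Buᵀ *ᵥ (P *ᵥ (S.A *ᵥ x)))) := by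
    conv_lhs => rw [← hric]
    simp only [riccati, add_mulVec, sub_mulVec, dotProduct_add, dotProduct_sub,
      mulVec_dotProduct_eq, mulVec_mulVec, transpose_mul, transpose_transpose, hPt,
      Matrix.mul_assoc]
  have hxs : x ⬝ᵥ ((S.Ahat P)ᵀ *ᵥ s) = (S.A *ᵥ x) ⬝ᵥ s -
      (S.Buᵀ *ᵥ s) ⬝ᵥ ((S.H P)⁻¹ *ᵥ (S.Buᵀ *ᵥ (P *ᵥ (S.A *ᵥ x)))) := by
    rw [← mulVec_dotProduct_eq, Ahat, sub_mulVec, sub_dotProduct, ← mulVec_mulVec,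
      mulVec_dotProduct_eq S.Bu, dotProduct_comm (S.Buᵀ *ᵥ s)]
    simp only [Kx, mulVec_mulVec, Matrix.mul_assoc]
  have hcross : (S.Buᵀ *ᵥ (P *ᵥ (S.A *ᵥ x))) ⬝ᵥ ((S.H P)⁻¹ *ᵥ (S.Buᵀ *ᵥ s)) =
      (S.Buᵀ *ᵥ s) ⬝ᵥ ((S.H P)⁻¹ *ᵥ (S.Buᵀ *ᵥ (P *ᵥ (S.A *ᵥ x)))) :=
    dotProduct_mulVec_comm hHit _ _
  have hdd : b 0 ⬝ᵥ ((S.Bwᵀ * P * S.Bw) *ᵥ b 0) = d ⬝ᵥ (P *ᵥ d) := by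
    simp only [hd, mulVec_dotProduct_eq, mulVec_mulVec, Matrix.mul_assoc]
  have hAs : (S.A *ᵥ x) ⬝ᵥ s = (S.A *ᵥ x) ⬝ᵥ (P *ᵥ d) + (S.A *ᵥ x) ⬝ᵥ v := by
    rw [hsv, dotProduct_add]
  have hAd : d ⬝ᵥ (P *ᵥ (S.A *ᵥ x)) = (S.A *ᵥ x) ⬝ᵥ (P *ᵥ d) := dotProduct_mulVec_comm hPt _ _
  rw [hy', hPe, hu] at h
  unfold costToGo windowCost
  rw [← hv, ← hs, ← hd, hss, hxs, hdd, hxx, stageCost]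
  simp only [mulVec_add, dotProduct_add, add_dotProduct] at h ⊢
  linarith

/-- The sum of the stage costs, by completion of squares. -/
theorem sum_stageCost_eq (hR : S.R.PosDef) (hP : P.PosSemidef) (hric : S.riccati P = P)
    {x : ℕ → Fin nx → ℝ} {u : ℕ → Fin nu → ℝ} {w : ℕ → Fin nw → ℝ}
    (hx : ∀ t, x (t + 1) = S.A *ᵥ x t + S.Bu *ᵥ u t + S.Bw *ᵥ w t) (T : ℕ) :
    ∑ t ∈ Finset.range T, S.stageCost (x t) (u t) =
      S.costToGo P (x 0) (window p w 0) - S.costToGo P (x T) (window p w T) +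
      ∑ t ∈ Finset.range T, (u t - S.previewAction P (x t) (window p w t)) ⬝ᵥ
        (S.H P *ᵥ (u t - S.previewAction P (x t) (window p w t))) +
      ∑ t ∈ Finset.range T, S.windowCost P (window p w t) +
      2 * ∑ t ∈ Finset.range T,
        x (t + 1) ⬝ᵥ (S.previewWeight P (p + 1) *ᵥ w (t + 1 + p)) := by
  induction T with
  | zero => simp
  | succ T ih =>
    simp only [Finset.sum_range_succ, ih]
    have h := stageCost_add_previewCost hR hP hric (x T) (u T) (window p w T) (x (T + 1))
      (by simpa [window] using hx T)
    have h2 : S.costToGo P (x (T + 1)) (window p w (T + 1)) = x (T + 1) ⬝ᵥ (P *ᵥ x (T + 1)) +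
        2 * (x (T + 1) ⬝ᵥ S.previewTail P (window p w T)) +
        2 * (x (T + 1) ⬝ᵥ (S.previewWeight P (p + 1) *ᵥ w (T + 1 + p))) := by
      rw [costToGo, Ahat_transpose_mulVec_previewSum, dotProduct_add]
      ring
    linarith

end LQRData

theorem previewTerm_eq {nx nu nw : ℕ} (S : LQRData nx nu nw) (P : Matrix (Fin nx) (Fin nx) ℝ)
    (p t : ℕ) (w : ℕ → Fin nw → ℝ) (y : Fin (t + 1) → Fin nx → ℝ) :
    previewTerm S P p t (y, fun s => w s) = S.previewTail P (LQRData.window p w t) := by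
  unfold previewTerm LQRData.previewTail LQRData.previewWeight LQRData.window
  refine (Finset.sum_bij (fun (j : Fin p) _ => (⟨t + (j + 1), by omega⟩ : Fin (t + p + 1)))
    ?_ ?_ ?_ ?_).symm
  · intro j _
    simp
  · intro i _ j _ h
    simp only [Fin.mk.injEq] at h
    exact Fin.ext (by omega)
  · intro j hj
    simp only [Finset.mem_filter, Finset.mem_univ, true_and] at hj
    exact ⟨⟨j - t - 1, by omega⟩, Finset.mem_univ _, Fin.ext (by simp; omega)⟩
  · intro j _
    simp

theorem previewLaw_eq {nx nu nw : ℕ} (S : LQRData nx nu nw) (P : Matrix (Fin nx) (Fin nx) ℝ)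
    (p t : ℕ) (x : ℕ → Fin nx → ℝ) (w : ℕ → Fin nw → ℝ) :
    previewLaw S P p t (fun s => x s, fun s => w s) =
      S.previewAction P (x t) (LQRData.window p w t) := by
  unfold previewLaw LQRData.previewAction
  rw [previewTerm_eq]
  simp [LQRData.window]

/-! ### Independence -/

section Independence

variable {Ω : Type*} {mΩ : MeasurableSpace Ω} {μ : Measure Ω}

/-- Functions of disjoint subfamilies of an independent family are independent. -/
theorem indepFun_of_measurable_iSup_comap {ι β γ δ : Type*} [MeasurableSpace β]
    [MeasurableSpace γ] [MeasurableSpace δ] {f : ι → Ω → β} (hf : iIndepFun f μ)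
    (hm : ∀ i, Measurable (f i)) {S T : Set ι} (hST : Disjoint S T) {X : Ω → γ} {Y : Ω → δ}
    (hX : Measurable[⨆ i ∈ S, MeasurableSpace.comap (f i) inferInstance] X)
    (hY : Measurable[⨆ i ∈ T, MeasurableSpace.comap (f i) inferInstance] Y) : IndepFun X Y μ := by
  have h := indep_iSup_of_disjoint (fun i => (hm i).comap_le) hf.iIndep hST
  exact indep_of_indep_of_le_left (indep_of_indep_of_le_right h hY.comap_le) hX.comap_le

theorem measurable_iSup_comap_pi {ι κ β : Type*} [MeasurableSpace β] {f : ι → Ω → β} {S : Set ι}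
    {g : κ → ι} (hg : ∀ k, g k ∈ S) :
    Measurable[⨆ i ∈ S, MeasurableSpace.comap (f i) inferInstance] fun ω k => f (g k) ω := by
  refine @measurable_pi_lambda _ _ _ (_) _ _ fun k => ?_
  refine Measurable.mono (comap_measurable (f (g k))) ?_ le_rfl
  exact le_iSup₂ (f := fun i (_ : i ∈ S) => MeasurableSpace.comap (f i) inferInstance) (g k) (hg k)

theorem indepFun_pi_pi {ι κ κ' β : Type*} [MeasurableSpace β] {f : ι → Ω → β} (hf : iIndepFun f μ)
    (hm : ∀ i, Measurable (f i)) {g : κ → ι} {g' : κ' → ι} (hgg : ∀ k k', g k ≠ g' k') :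
    IndepFun (fun ω k => f (g k) ω) (fun ω k => f (g' k) ω) μ := by
  refine indepFun_of_measurable_iSup_comap (S := Set.range g) (T := Set.range g') hf hm ?_
    (measurable_iSup_comap_pi fun k => ⟨k, rfl⟩) (measurable_iSup_comap_pi fun k => ⟨k, rfl⟩)
  rw [Set.disjoint_left]
  rintro _ ⟨k, rfl⟩ ⟨k', hk⟩
  exact hgg k k' hk.symm

theorem _root_.ProbabilityTheory.IndepFun.prodMk_left_of_prodMk_right [IsFiniteMeasure μ]
    {α β γ : Type*} [MeasurableSpace α] [MeasurableSpace β] [MeasurableSpace γ]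
    {X : Ω → α} {Y : Ω → β} {Z : Ω → γ} (hX : Measurable X) (hY : Measurable Y) (hZ : Measurable Z)
    (h : IndepFun X (fun ω => (Y ω, Z ω)) μ) (hYZ : IndepFun Y Z μ) :
    IndepFun (fun ω => (X ω, Y ω)) Z μ := by
  have hXY : IndepFun X Y μ := h.comp measurable_id measurable_fst
  rw [indepFun_iff_map_prod_eq_prod_map_map hX.aemeasurable (hY.prodMk hZ).aemeasurable,
    (indepFun_iff_map_prod_eq_prod_map_map hY.aemeasurable hZ.aemeasurable).1 hYZ] at h
  rw [indepFun_iff_map_prod_eq_prod_map_map (hX.prodMk hY).aemeasurable hZ.aemeasurable,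
    (indepFun_iff_map_prod_eq_prod_map_map hX.aemeasurable hY.aemeasurable).1 hXY]
  have h2 := congrArg (Measure.map (MeasurableEquiv.prodAssoc (α := α) (β := β) (γ := γ)).symm) h
  rw [Measure.map_map (MeasurableEquiv.measurable _) (by fun_prop)] at h2
  refine h2.trans ?_
  exact (MeasurableEquiv.map_apply_eq_iff_map_symm_apply_eq _).1 Measure.prodAssoc_prod |>.symm

/-- A variable drawn from a kernel applied to `Y` only leaves the pair independent of what `Y` is
independent of. -/
theorem indepFun_prodMk_of_hasCondDistrib [IsProbabilityMeasure μ] {α β γ : Type*}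
    [MeasurableSpace α] [MeasurableSpace β] [MeasurableSpace γ] {U : Ω → α} {Y : Ω → β} {Z : Ω → γ}
    {κ : Kernel β α} [IsMarkovKernel κ] (hU : Measurable U) (hY : Measurable Y) (hZ : Measurable Z)
    (h : HasCondDistrib U (fun ω => (Y ω, Z ω))
      (κ.comap Prod.fst (measurable_fst : Measurable (Prod.fst : β × γ → β))) μ)
    (hYZ : IndepFun Y Z μ) : IndepFun (fun ω => (Y ω, U ω)) Z μ := by
  have h1 : HasCondDistrib U Y κ μ := h.comp_right
  have hlaw := (indepFun_iff_map_prod_eq_prod_map_map hY.aemeasurable hZ.aemeasurable).1 hYZ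
  have : IsProbabilityMeasure (μ.map Y) := Measure.isProbabilityMeasure_map hY.aemeasurable
  have : IsProbabilityMeasure (μ.map Z) := Measure.isProbabilityMeasure_map hZ.aemeasurable
  rw [indepFun_iff_measure_inter_preimage_eq_mul]
  intro s t hs ht
  have e1 : μ ((fun ω => (Y ω, U ω)) ⁻¹' s) = ∫⁻ y, κ y (Prod.mk y ⁻¹' s) ∂(μ.map Y) := by
    rw [← Measure.map_apply (hY.prodMk hU) hs, h1.map_eq, Measure.compProd_apply hs]
  have hs' : MeasurableSet {q : (β × γ) × α | (q.1.1, q.2) ∈ s ∧ q.1.2 ∈ t} :=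
    (hs.preimage (f := fun q : (β × γ) × α => (q.1.1, q.2)) (by fun_prop)).inter
      (ht.preimage (f := fun q : (β × γ) × α => q.1.2) (by fun_prop))
  have e2 : μ ((fun ω => (Y ω, U ω)) ⁻¹' s ∩ Z ⁻¹' t) =
      ∫⁻ q, κ q.1 (Prod.mk q.1 ⁻¹' s) * t.indicator 1 q.2 ∂((μ.map Y).prod (μ.map Z)) := by
    have : (fun ω => (Y ω, U ω)) ⁻¹' s ∩ Z ⁻¹' t = (fun ω => ((Y ω, Z ω), U ω)) ⁻¹'
      {q : (β × γ) × α | (q.1.1, q.2) ∈ s ∧ q.1.2 ∈ t} := rfl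
    rw [this, ← Measure.map_apply ((hY.prodMk hZ).prodMk hU) hs', h.map_eq,
      Measure.compProd_apply hs', hlaw]
    refine lintegral_congr fun q => ?_
    rw [Kernel.comap_apply]
    by_cases hq : q.2 ∈ t
    · simp [hq, Set.preimage]
    · simp [hq, Set.preimage]
  rw [e1, e2, lintegral_prod_mul (Kernel.measurable_kernel_prodMk_left hs).aemeasurable
    (by fun_prop (disch := exact ht)), lintegral_indicator_one ht, Measure.map_apply hZ ht]

end Independence

/-! ### Almost sure convergence of averages -/

section Averages

variable {Ω : Type*} {mΩ : MeasurableSpace Ω} {μ : Measure Ω}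

theorem ae_tendsto_zero_of_integral_le {g : ℕ → Ω → ℝ} {a : ℕ → ℝ}
    (hg : ∀ n, Integrable (g n) μ) (hg0 : ∀ n ω, 0 ≤ g n ω) (hle : ∀ n, ∫ ω, g n ω ∂μ ≤ a n)
    (ha : Summable a) : ∀ᵐ ω ∂μ, Tendsto (fun n => g n ω) atTop (𝓝 0) := by
  have ha0 : ∀ n, 0 ≤ a n := fun n => (integral_nonneg (hg0 n)).trans (hle n)
  have h1 : ∀ n, ∫⁻ ω, ENNReal.ofReal (g n ω) ∂μ ≤ ENNReal.ofReal (a n) := fun n => by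
    rw [← ofReal_integral_eq_lintegral_ofReal (hg n) (Eventually.of_forall (hg0 n))]
    exact ENNReal.ofReal_le_ofReal (hle n)
  have hmeas : ∀ n, AEMeasurable (fun ω => ENNReal.ofReal (g n ω)) μ := fun n =>
    (hg n).aemeasurable.ennreal_ofReal
  have h2 : ∫⁻ ω, ∑' n, ENNReal.ofReal (g n ω) ∂μ ≠ ∞ := by
    rw [lintegral_tsum hmeas]
    refine ne_top_of_le_ne_top ?_ (ENNReal.tsum_le_tsum h1)
    rw [← ENNReal.ofReal_tsum_of_nonneg ha0 ha]
    exact ENNReal.ofReal_ne_top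
  filter_upwards [ae_lt_top' (AEMeasurable.tsum hmeas) h2] with ω hω
  have h3 := ENNReal.tendsto_atTop_zero_of_tsum_ne_top hω.ne
  have h4 := (ENNReal.tendsto_toReal ENNReal.zero_ne_top).comp h3
  refine h4.congr fun n => ?_
  simp [hg0 n ω]

theorem summable_div_mul_sq (c : ℝ) (d : ℕ) :
    Summable fun n : ℕ => c / ((d * n ^ 2 : ℕ) : ℝ) := by
  have h := (Real.summable_one_div_nat_pow.2 one_lt_two).mul_left (c / d)
  refine h.congr fun n => ?_
  push_cast
  rw [div_mul_div_comm, mul_one]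

/-- A sequence that is bounded in `L¹`, divided by `T`, tends to `0` along the times `d * n ^ 2`. -/
theorem ae_tendsto_div_of_integral_le {g : ℕ → Ω → ℝ} {C : ℝ} (hg : ∀ n, Integrable (g n) μ)
    (hle : ∀ n, ∫ ω, |g n ω| ∂μ ≤ C) (d : ℕ) :
    ∀ᵐ ω ∂μ, Tendsto (fun n => g (d * n ^ 2) ω / ((d * n ^ 2 : ℕ) : ℝ)) atTop (𝓝 0) := by
  have h := ae_tendsto_zero_of_integral_le (μ := μ)
    (g := fun n ω => |g (d * n ^ 2) ω| / ((d * n ^ 2 : ℕ) : ℝ))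
    (a := fun n => C / ((d * n ^ 2 : ℕ) : ℝ)) (fun n => (hg _).abs.div_const _)
    (fun n ω => by positivity)
    (fun n => by
      rw [integral_div]
      exact div_le_div_of_nonneg_right (hle _) (Nat.cast_nonneg _))
    (summable_div_mul_sq C d)
  filter_upwards [h] with ω hω
  rw [tendsto_zero_iff_abs_tendsto_zero]
  refine hω.congr fun n => ?_
  simp only [Function.comp, abs_div, Nat.abs_cast]

/-- The averages of an orthogonal, bounded sequence in `L²` tend to `0` along `d * n ^ 2`. -/
theorem ae_tendsto_average_of_orthogonal {z : ℕ → Ω → ℝ} {C : ℝ} (hz : ∀ n, MemLp (z n) 2 μ)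
    (hle : ∀ n, ∫ ω, z n ω ^ 2 ∂μ ≤ C) (horth : ∀ i j, i < j → ∫ ω, z i ω * z j ω ∂μ = 0)
    (d : ℕ) :
    ∀ᵐ ω ∂μ, Tendsto (fun n => (∑ i ∈ Finset.range (d * n ^ 2), z i ω) / ((d * n ^ 2 : ℕ) : ℝ))
      atTop (𝓝 0) := by
  have hint : ∀ i j, Integrable (fun ω => z i ω * z j ω) μ := fun i j =>
    (hz i).integrable_mul (hz j)
  have hsum : ∀ N, MemLp (fun ω => ∑ i ∈ Finset.range N, z i ω) 2 μ := fun N =>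
    memLp_finsetSum _ fun i _ => hz i
  have hsq : ∀ N : ℕ, ∫ ω, (∑ i ∈ Finset.range N, z i ω) ^ 2 ∂μ ≤ N * C := by
    intro N
    induction N with
    | zero => simp
    | succ N ih =>
      have hcross : Integrable (fun ω => (∑ i ∈ Finset.range N, z i ω) * z N ω) μ :=
        (hsum N).integrable_mul (hz N)
      have hcross0 : ∫ ω, (∑ i ∈ Finset.range N, z i ω) * z N ω ∂μ = 0 := by
        simp_rw [Finset.sum_mul]
        rw [integral_finsetSum _ fun i _ => hint i N]
        exact Finset.sum_eq_zero fun i hi => horth i N (Finset.mem_range.1 hi)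
      have heq : ∀ ω, (∑ i ∈ Finset.range (N + 1), z i ω) ^ 2 =
          (∑ i ∈ Finset.range N, z i ω) ^ 2 + z N ω ^ 2 +
            2 * ((∑ i ∈ Finset.range N, z i ω) * z N ω) := fun ω => by
        rw [Finset.sum_range_succ]; ring
      have hsq2 : Integrable (fun ω => (∑ i ∈ Finset.range N, z i ω) ^ 2 + z N ω ^ 2) μ :=
        (hsum N).integrable_sq.add (hz N).integrable_sq
      simp_rw [heq]
      rw [integral_add hsq2 (hcross.const_mul 2),
        integral_add (hsum N).integrable_sq (hz N).integrable_sq, integral_const_mul, hcross0]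
      push_cast
      linarith [hle N]
  have h := ae_tendsto_zero_of_integral_le (μ := μ)
    (g := fun n ω => ((∑ i ∈ Finset.range (d * n ^ 2), z i ω) / ((d * n ^ 2 : ℕ) : ℝ)) ^ 2)
    (a := fun n => C / ((d * n ^ 2 : ℕ) : ℝ)) (fun n => ?_) (fun n ω => by positivity)
    (fun n => ?_) (summable_div_mul_sq C d)
  · filter_upwards [h] with ω hω
    rw [tendsto_zero_iff_abs_tendsto_zero]
    have h2 := (Real.continuous_sqrt.tendsto 0).comp hω
    rw [Real.sqrt_zero] at h2
    refine h2.congr fun n => ?_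
    simp only [Function.comp, Real.sqrt_sq_eq_abs]
  · simp_rw [div_pow]
    exact (hsum _).integrable_sq.div_const _
  · simp_rw [div_pow]
    rw [integral_div]
    rcases Nat.eq_zero_or_pos (d * n ^ 2) with h0 | h0
    · simp [h0]
    · have h1 : (0 : ℝ) < ((d * n ^ 2 : ℕ) : ℝ) := by exact_mod_cast h0
      rw [div_le_div_iff₀ (by positivity) h1]
      nlinarith [hsq (d * n ^ 2)]

theorem sum_range_mul_eq {M : Type*} [AddCommMonoid M] (f : ℕ → M) (d m : ℕ) :
    ∑ t ∈ Finset.range (d * m), f t = ∑ i ∈ Finset.range d, ∑ k ∈ Finset.range m, f (i + d * k) := by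
  induction m with
  | zero => simp
  | succ m ih =>
    rw [Nat.mul_succ, Finset.sum_range_add, ih, ← Finset.sum_add_distrib]
    refine Finset.sum_congr rfl fun i _ => ?_
    rw [Finset.sum_range_succ, add_comm (d * m) i]

theorem identDistrib_window [IsProbabilityMeasure μ] {α : Type*} [MeasurableSpace α]
    {w : ℕ → Ω → α} (hm : ∀ t, Measurable (w t)) (hw : iIndepFun w μ)
    (hid : ∀ s t, IdentDistrib (w s) (w t) μ μ) (p s t : ℕ) :
    IdentDistrib (fun ω => LQRData.window p (fun t => w t ω) s)
      (fun ω => LQRData.window p (fun t => w t ω) t) μ μ := by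
  have hmeas : ∀ s, Measurable fun ω => LQRData.window p (fun t => w t ω) s := fun s =>
    measurable_pi_lambda _ fun j => hm _
  have hmap : ∀ s, μ.map (fun ω => LQRData.window p (fun t => w t ω) s) =
      Measure.pi fun _ : Fin (p + 1) => μ.map (w 0) := by
    intro s
    have h1 : iIndepFun (fun j : Fin (p + 1) => w (s + j)) μ :=
      hw.precomp (g := fun j : Fin (p + 1) => s + (j : ℕ)) fun i j h => Fin.ext (by simpa using h)
    have h2 := h1.map_fun_eq_pi_map fun j => (hm _).aemeasurable
    refine h2.trans ?_
    congr 1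
    ext1 j
    exact (hid _ _).map_eq
  exact ⟨(hmeas s).aemeasurable, (hmeas t).aemeasurable, (hmap s).trans (hmap t).symm⟩

/-- The strong law of large numbers for functions of a moving window. -/
theorem ae_tendsto_average_window [IsProbabilityMeasure μ] {α : Type*} [MeasurableSpace α]
    {w : ℕ → Ω → α} (hm : ∀ t, Measurable (w t)) (hw : iIndepFun w μ)
    (hid : ∀ s t, IdentDistrib (w s) (w t) μ μ) {p : ℕ} {f : (Fin (p + 1) → α) → ℝ}
    (hf : Measurable f) {c : ℝ}
    (hint : ∀ t, Integrable (fun ω => f (LQRData.window p (fun t => w t ω) t)) μ)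
    (hc : ∀ t, ∫ ω, f (LQRData.window p (fun t => w t ω) t) ∂μ = c) :
    ∀ᵐ ω ∂μ, Tendsto (fun m : ℕ => (∑ t ∈ Finset.range ((p + 1) * m),
      f (LQRData.window p (fun t => w t ω) t)) / (((p + 1) * m : ℕ) : ℝ)) atTop (𝓝 c) := by
  have h1 : ∀ i : ℕ, ∀ᵐ ω ∂μ, Tendsto (fun m : ℕ => (∑ k ∈ Finset.range m,
      f (LQRData.window p (fun t => w t ω) (i + (p + 1) * k))) / (m : ℝ)) atTop (𝓝 c) := by
    intro i
    have h := strong_law_ae_real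
      (fun k ω => f (LQRData.window p (fun t => w t ω) (i + (p + 1) * k))) (hint _) ?_
      (fun k => (identDistrib_window hm hw hid p _ _).comp hf)
    · simpa only [hc] using h
    · intro k l hkl
      have hkl' : k ≠ l := hkl
      have h2 : IndepFun (fun ω => LQRData.window p (fun t => w t ω) (i + (p + 1) * k))
          (fun ω => LQRData.window p (fun t => w t ω) (i + (p + 1) * l)) μ := by
        refine indepFun_pi_pi hw hm (g := fun j : Fin (p + 1) => i + (p + 1) * k + (j : ℕ))
          (g' := fun j : Fin (p + 1) => i + (p + 1) * l + (j : ℕ)) fun a b hab => ?_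
        have ha := a.2
        have hb := b.2
        rcases lt_or_gt_of_ne hkl' with h | h
        · have : (p + 1) * (k + 1) ≤ (p + 1) * l := Nat.mul_le_mul_left _ h
          rw [Nat.mul_succ] at this
          omega
        · have : (p + 1) * (l + 1) ≤ (p + 1) * k := Nat.mul_le_mul_left _ h
          rw [Nat.mul_succ] at this
          omega
      exact h2.comp hf hf
  filter_upwards [ae_all_iff.2 h1] with ω hω
  have h3 := (tendsto_finsetSum (Finset.range (p + 1)) fun i _ => hω i).div_const ((p + 1 : ℕ) : ℝ)
  have h4 : (∑ _i ∈ Finset.range (p + 1), c) / ((p + 1 : ℕ) : ℝ) = c := by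
    rw [Finset.sum_const, Finset.card_range, nsmul_eq_mul, mul_div_cancel_left₀]
    positivity
  rw [h4] at h3
  refine h3.congr fun m => ?_
  rw [sum_range_mul_eq, ← Finset.sum_div, div_div, mul_comm (m : ℝ), Nat.cast_mul]

end Averages

/-! ### Moments of the disturbance -/

section Noise

variable {Ω : Type*} [MeasurableSpace Ω] {μ : Measure Ω} {nx nu nw : ℕ}
  {w : ℕ → Ω → Fin nw → ℝ}

theorem IsNoise.memLp_apply (hw : IsNoise μ w) (t : ℕ) (a : Fin nw) :
    MemLp (fun ω => w t ω a) 2 μ :=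
  (hw.memLp t).eval a

theorem integrable_dotProduct_mulVec {m n : ℕ} {f : Ω → Fin m → ℝ} {g : Ω → Fin n → ℝ}
    (hf : MemLp f 2 μ) (hg : MemLp g 2 μ) (M : Matrix (Fin m) (Fin n) ℝ) :
    Integrable (fun ω => f ω ⬝ᵥ (M *ᵥ g ω)) μ := by
  simp only [dotProduct, mulVec, Finset.mul_sum]
  refine integrable_finsetSum _ fun a _ => integrable_finsetSum _ fun b _ => ?_
  refine (((hf.eval a).integrable_mul (hg.eval b)).const_mul (M a b)).congr
    (Eventually.of_forall fun ω => ?_)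
  simp only [Pi.mul_apply]
  ring

theorem IsNoise.integral_dotProduct_mulVec (hw : IsNoise μ w) (s t : ℕ)
    (M : Matrix (Fin nw) (Fin nw) ℝ) :
    ∫ ω, w s ω ⬝ᵥ (M *ᵥ w t ω) ∂μ = if s = t then M.trace else 0 := by
  have hint : ∀ a b, Integrable (fun ω => M a b * (w s ω a * w t ω b)) μ := fun a b =>
    ((hw.memLp_apply s a).integrable_mul (hw.memLp_apply t b)).const_mul (M a b)
  have h1 : ∀ ω, w s ω ⬝ᵥ (M *ᵥ w t ω) = ∑ a, ∑ b, M a b * (w s ω a * w t ω b) := by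
    intro ω
    simp only [dotProduct, mulVec, Finset.mul_sum]
    exact Finset.sum_congr rfl fun a _ => Finset.sum_congr rfl fun b _ => by ring
  simp_rw [h1]
  rw [integral_finsetSum _ fun a _ => integrable_finsetSum _ fun b _ => hint a b]
  simp_rw [integral_finsetSum _ fun b _ => hint _ b, integral_const_mul, hw.covariance]
  by_cases hst : s = t
  · simp [hst, Matrix.trace]
  · simp [hst]

theorem IsNoise.integral_dotProduct_self (hw : IsNoise μ w) (t : ℕ) :
    ∫ ω, w t ω ⬝ᵥ w t ω ∂μ = nw := by
  have h := hw.integral_dotProduct_mulVec t t 1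
  simpa using h

namespace LQRData

variable (S : LQRData nx nu nw) (P : Matrix (Fin nx) (Fin nx) ℝ) (p : ℕ)

theorem windowCost_eq (b : Fin (p + 1) → Fin nw → ℝ) : S.windowCost P b =
    b 0 ⬝ᵥ ((S.Bwᵀ * P * S.Bw) *ᵥ b 0) +
    2 * ∑ j : Fin p, b 0 ⬝ᵥ ((S.Bwᵀ * S.previewWeight P (j + 1)) *ᵥ b j.succ) -
    ∑ i : Fin (p + 1), ∑ j : Fin (p + 1), b i ⬝ᵥ (((S.Kv P * S.previewWeight P i)ᵀ * S.H P *
      (S.Kv P * S.previewWeight P j)) *ᵥ b j) := by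
  unfold windowCost previewTail previewSum
  congr 1
  · congr 2
    rw [mulVec_dotProduct_eq, mulVec_sum, dotProduct_sum]
    simp only [mulVec_mulVec]
  · simp only [mulVec_sum, sum_dotProduct, dotProduct_sum, mulVec_mulVec, mulVec_dotProduct_eq,
      Matrix.mul_assoc]
    exact Finset.sum_comm

theorem optimalValue_eq (hP : Pᵀ = P) : S.optimalValue P p =
    (S.Bwᵀ * P * S.Bw).trace - ∑ j : Fin (p + 1), ((S.Kv P * S.previewWeight P j)ᵀ * S.H P *
      (S.Kv P * S.previewWeight P j)).trace := by
  unfold optimalValue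
  rw [Finset.sum_range, trace_mul_comm (P * S.Bw), ← Matrix.mul_assoc]
  congr 1
  refine Finset.sum_congr rfl fun j _ => ?_
  rw [Matrix.mul_assoc (S.Kv P * S.previewWeight P j)ᵀ, trace_mul_comm _ (S.H P * _)]
  simp only [previewWeight, transpose_mul, transpose_pow, transpose_transpose, hP,
    Matrix.mul_assoc]

theorem measurable_windowCost : Measurable (S.windowCost P : (Fin (p + 1) → Fin nw → ℝ) → ℝ) := by
  refine Continuous.measurable ?_
  unfold windowCost previewTail previewSum
  fun_prop

variable {p}

theorem integrable_windowCost (hw : IsNoise μ w) (t : ℕ) :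
    Integrable (fun ω => S.windowCost P (window p (fun t => w t ω) t)) μ := by
  simp_rw [windowCost_eq]
  refine Integrable.sub (Integrable.add ?_ (Integrable.const_mul ?_ 2)) ?_
  · exact integrable_dotProduct_mulVec (hw.memLp _) (hw.memLp _) _
  · exact integrable_finsetSum _ fun j _ =>
      integrable_dotProduct_mulVec (hw.memLp _) (hw.memLp _) _
  · exact integrable_finsetSum _ fun i _ => integrable_finsetSum _ fun j _ =>
      integrable_dotProduct_mulVec (hw.memLp _) (hw.memLp _) _

variable {P}

theorem integral_windowCost (hP : Pᵀ = P) (hw : IsNoise μ w) (t : ℕ) :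
    ∫ ω, S.windowCost P (window p (fun t => w t ω) t) ∂μ = S.optimalValue P p := by
  have hint : ∀ (s t : ℕ) (M : Matrix (Fin nw) (Fin nw) ℝ),
      Integrable (fun ω => w s ω ⬝ᵥ (M *ᵥ w t ω)) μ := fun s t M =>
    integrable_dotProduct_mulVec (hw.memLp _) (hw.memLp _) _
  simp_rw [windowCost_eq, window]
  rw [integral_sub, integral_add, integral_const_mul, integral_finsetSum, integral_finsetSum]
  rotate_left
  · exact fun i _ => integrable_finsetSum _ fun j _ => hint _ _ _
  · exact fun j _ => hint _ _ _
  · exact hint _ _ _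
  · exact (integrable_finsetSum _ fun j _ => hint _ _ _).const_mul 2
  · exact (hint _ _ _).add ((integrable_finsetSum _ fun j _ => hint _ _ _).const_mul 2)
  · exact integrable_finsetSum _ fun i _ => integrable_finsetSum _ fun j _ => hint _ _ _
  have h1 : ∀ i : Fin (p + 1), ∫ ω, ∑ j : Fin (p + 1), w (t + i) ω ⬝ᵥ
      (((S.Kv P * S.previewWeight P i)ᵀ * S.H P * (S.Kv P * S.previewWeight P j)) *ᵥ
        w (t + j) ω) ∂μ =
      ((S.Kv P * S.previewWeight P i)ᵀ * S.H P * (S.Kv P * S.previewWeight P i)).trace := by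
    intro i
    rw [integral_finsetSum _ fun j _ => hint _ _ _]
    simp_rw [hw.integral_dotProduct_mulVec]
    rw [Finset.sum_eq_single i]
    · simp
    · intro j _ hj
      rw [if_neg]
      intro h
      exact hj (Fin.ext (by omega))
    · simp
  simp_rw [h1, hw.integral_dotProduct_mulVec]
  rw [optimalValue_eq _ _ _ hP, Finset.sum_eq_zero]
  · simp
  · intro j _
    rw [if_neg]
    simp

end LQRData

end Noise

/-! ### Closed loops -/

section ClosedLoop

variable {Ω : Type*} [MeasurableSpace Ω] {μ : Measure Ω} {nx nu nw p : ℕ}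
  {S : LQRData nx nu nw} {K : Policy nx nu nw p} {w : ℕ → Ω → Fin nw → ℝ} {x₀ : Ω → Fin nx → ℝ}
  {x : ℕ → Ω → Fin nx → ℝ} {u : ℕ → Ω → Fin nu → ℝ}

theorem IsClosedLoop.measurable_x (h : IsClosedLoop S K μ w x₀ x u) (hw : IsNoise μ w)
    (h0 : IsInitial μ w x₀) (t : ℕ) : Measurable (x t) := by
  induction t with
  | zero => rw [h.init]; exact h0.measurable
  | succ t ih =>
    have h1 : x (t + 1) = fun ω => S.A *ᵥ x t ω + S.Bu *ᵥ u t ω + S.Bw *ᵥ w t ω :=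
      funext (h.step t)
    have hu := h.measurable_u t
    have hwt := hw.measurable t
    have h2 : Measurable fun q : (Fin nx → ℝ) × (Fin nu → ℝ) × (Fin nw → ℝ) =>
        S.A *ᵥ q.1 + S.Bu *ᵥ q.2.1 + S.Bw *ᵥ q.2.2 := by
      refine Continuous.measurable ?_
      fun_prop
    rw [h1]
    exact h2.comp (ih.prodMk (hu.prodMk hwt))

theorem IsClosedLoop.measurable_info (h : IsClosedLoop S K μ w x₀ x u) (hw : IsNoise μ w)
    (h0 : IsInitial μ w x₀) (t : ℕ) : Measurable (info p x w t) :=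
  (measurable_pi_lambda _ fun _ => h.measurable_x hw h0 _).prodMk
    (measurable_pi_lambda _ fun _ => hw.measurable _)

variable [IsProbabilityMeasure μ]

theorem IsClosedLoop.indepFun_info_action_of_indepFun_info (h : IsClosedLoop S K μ w x₀ x u)
    (hw : IsNoise μ w) (h0 : IsInitial μ w x₀) (t : ℕ)
    (hi : IndepFun (info p x w t) (fun ω (k : ℕ) => w (t + p + 1 + k) ω) μ) :
    IndepFun (fun ω => (info p x w t ω, u t ω)) (fun ω (k : ℕ) => w (t + p + 1 + k) ω) μ := by
  have := K.isMarkov t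
  refine indepFun_prodMk_of_hasCondDistrib (κ := K.kernel t) (h.measurable_u t)
    (h.measurable_info hw h0 t) (measurable_pi_lambda _ fun k => hw.measurable _) ?_ hi
  have hf : Measurable fun q : History nx nu nw t =>
      (infoOfHistory nx nu nw p t q, fun k : ℕ => q.2.1 (t + p + 1 + k)) :=
    (measurable_infoOfHistory nx nu nw p t).prodMk (by fun_prop)
  exact HasCondDistrib.comp_right (hf := hf) (Z := history x w u t) (h.law t)

theorem IsClosedLoop.indepFun_info (h : IsClosedLoop S K μ w x₀ x u)
    (hw : IsNoise μ w) (h0 : IsInitial μ w x₀) (t : ℕ) :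
    IndepFun (info p x w t) (fun ω (k : ℕ) => w (t + p + 1 + k) ω) μ := by
  have hmw : ∀ m, Measurable fun ω (k : ℕ) => w (m + k) ω := fun m =>
    measurable_pi_lambda _ fun k => hw.measurable _
  induction t with
  | zero =>
    have hm : Measurable fun ω (k : Fin (0 + p + 1)) => w k ω :=
      measurable_pi_lambda _ fun k => hw.measurable _
    have h1 : IndepFun x₀ (fun ω => ((fun k : Fin (0 + p + 1) => w k ω),
        fun k : ℕ => w (0 + p + 1 + k) ω)) μ :=
      h0.indep.comp (ψ := fun q : ℕ → Fin nw → ℝ => ((fun k : Fin (0 + p + 1) => q k),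
        fun k : ℕ => q (0 + p + 1 + k))) measurable_id (by fun_prop)
    have h2 : IndepFun (fun ω (k : Fin (0 + p + 1)) => w k ω)
        (fun ω (k : ℕ) => w (0 + p + 1 + k) ω) μ :=
      indepFun_pi_pi hw.indep hw.measurable (g := fun k : Fin (0 + p + 1) => (k : ℕ))
        (g' := fun k => 0 + p + 1 + k) fun a b => by have := a.2; omega
    have h3 := h1.prodMk_left_of_prodMk_right h0.measurable hm (hmw _) h2
    have h4 := h3.comp (φ := fun q : (Fin nx → ℝ) × (Fin (0 + p + 1) → Fin nw → ℝ) =>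
      ((fun _ => q.1, q.2) : Info nx nw p 0)) (by fun_prop) measurable_id
    refine h4.congr (Eventually.of_forall fun ω => ?_) (Eventually.of_forall fun ω => rfl)
    refine Prod.ext (funext fun s => ?_) rfl
    simp [info, h.init]
  | succ t ih =>
    have h1 := h.indepFun_info_action_of_indepFun_info hw h0 t ih
    have h2 : IndepFun (fun ω => (info p x w t ω, u t ω)) (fun ω => (w (t + p + 1) ω,
        fun k : ℕ => w (t + 1 + p + 1 + k) ω)) μ := by
      have := h1.comp (ψ := fun q : ℕ → Fin nw → ℝ => (q 0, fun k => q (k + 1))) measurable_id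
        (by fun_prop)
      refine this.congr (Eventually.of_forall fun ω => rfl) (Eventually.of_forall fun ω => ?_)
      refine Prod.ext rfl (funext fun k => ?_)
      change w (t + p + 1 + (k + 1)) ω = w (t + 1 + p + 1 + k) ω
      rw [show t + p + 1 + (k + 1) = t + 1 + p + 1 + k by omega]
    have h3 : IndepFun (w (t + p + 1)) (fun ω (k : ℕ) => w (t + 1 + p + 1 + k) ω) μ := by
      have := indepFun_pi_pi hw.indep hw.measurable (g := fun _ : Unit => t + p + 1)
        (g' := fun k => t + 1 + p + 1 + k) fun a b => by omega
      exact this.comp (φ := fun q : Unit → Fin nw → ℝ => q ()) (by fun_prop) measurable_id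
    have h4 := h2.prodMk_left_of_prodMk_right
      ((h.measurable_info hw h0 t).prodMk (h.measurable_u t)) (hw.measurable _) (hmw _) h3
    let φ : (Info nx nw p t × (Fin nu → ℝ)) × (Fin nw → ℝ) → Info nx nw p (t + 1) := fun q =>
      (fun s => if hs : (s : ℕ) < t + 1 then q.1.1.1 ⟨s, hs⟩ else
        S.A *ᵥ q.1.1.1 (Fin.last t) + S.Bu *ᵥ q.1.2 + S.Bw *ᵥ q.1.1.2 ⟨t, by omega⟩,
      fun s => if hs : (s : ℕ) < t + p + 1 then q.1.1.2 ⟨s, hs⟩ else q.2)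
    have hφ : Measurable φ := by
      refine (measurable_pi_lambda _ fun s => ?_).prodMk (measurable_pi_lambda _ fun s => ?_)
      · by_cases hs : (s : ℕ) < t + 1
        · simp only [hs, dite_true]
          fun_prop
        · simp only [hs, dite_false]
          refine Continuous.measurable ?_
          fun_prop
      · by_cases hs : (s : ℕ) < t + p + 1
        · simp only [hs, dite_true]
          fun_prop
        · simp only [hs, dite_false]
          fun_prop
    have h5 := h4.comp hφ measurable_id
    refine h5.congr (Eventually.of_forall fun ω => ?_) (Eventually.of_forall fun ω => rfl)
    refine Prod.ext (funext fun s => ?_) (funext fun s => ?_)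
    · by_cases hs : (s : ℕ) < t + 1
      · simp [φ, info]
        omega
      · have hs' : (s : ℕ) = t + 1 := by omega
        simp [φ, info, hs', h.step]
    · by_cases hs : (s : ℕ) < t + p + 1
      · simp [φ, info]
        omega
      · have hs' : (s : ℕ) = t + p + 1 := by omega
        simp [φ, info, hs']

theorem IsClosedLoop.indepFun_info_action (h : IsClosedLoop S K μ w x₀ x u)
    (hw : IsNoise μ w) (h0 : IsInitial μ w x₀) (t : ℕ) :
    IndepFun (fun ω => (info p x w t ω, u t ω)) (w (t + 1 + p)) μ := by
  have hm : Measurable fun q : ℕ → Fin nw → ℝ => q 0 := measurable_pi_apply 0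
  have h1 := (h.indepFun_info_action_of_indepFun_info hw h0 t (h.indepFun_info hw h0 t)).comp
    measurable_id hm
  refine h1.congr (Eventually.of_forall fun ω => rfl) (Eventually.of_forall fun ω => ?_)
  change w (t + p + 1 + 0) ω = w (t + 1 + p) ω
  rw [show t + p + 1 + 0 = t + 1 + p by omega]

end ClosedLoop

/-! ### The average cost of a stabilizing policy -/

theorem norm_sq_le_dotProduct_self {n : ℕ} (x : Fin n → ℝ) : ‖x‖ ^ 2 ≤ x ⬝ᵥ x := by
  have h0 : 0 ≤ x ⬝ᵥ x := Finset.sum_nonneg fun i _ => mul_self_nonneg _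
  have h1 : ‖x‖ ≤ √(x ⬝ᵥ x) := by
    refine (pi_norm_le_iff_of_nonneg (Real.sqrt_nonneg _)).2 fun i => ?_
    rw [Real.norm_eq_abs, ← Real.sqrt_sq_eq_abs]
    refine Real.sqrt_le_sqrt ?_
    rw [sq]
    exact Finset.single_le_sum (f := fun i => x i * x i) (fun i _ => mul_self_nonneg _)
      (Finset.mem_univ i)
  calc ‖x‖ ^ 2 ≤ √(x ⬝ᵥ x) ^ 2 := by gcongr
    _ = x ⬝ᵥ x := Real.sq_sqrt h0

theorem abs_dotProduct_mulVec_le_add {m n : ℕ} (M : Matrix (Fin m) (Fin n) ℝ) :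
    ∃ c, 0 ≤ c ∧ ∀ (x : Fin m → ℝ) (y : Fin n → ℝ), |x ⬝ᵥ (M *ᵥ y)| ≤ c * (x ⬝ᵥ x + y ⬝ᵥ y) := by
  obtain ⟨c, hc, h⟩ := LQRData.abs_dotProduct_mulVec_le M
  refine ⟨c, hc, fun x y => (h x y).trans (mul_le_mul_of_nonneg_left ?_ hc)⟩
  nlinarith [norm_sq_le_dotProduct_self x, norm_sq_le_dotProduct_self y, sq_nonneg (‖x‖ - ‖y‖),
    sq_nonneg ‖x‖, sq_nonneg ‖y‖]

theorem LQRData.abs_costToGo_le {nx nu nw p : ℕ} (S : LQRData nx nu nw)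
    (P : Matrix (Fin nx) (Fin nx) ℝ) : ∃ c, 0 ≤ c ∧ ∀ (x : Fin nx → ℝ)
      (b : Fin (p + 1) → Fin nw → ℝ), |S.costToGo P x b| ≤ c * (x ⬝ᵥ x + ∑ j, b j ⬝ᵥ b j) := by
  obtain ⟨c₀, hc₀, h₀⟩ := abs_dotProduct_mulVec_le_add P
  choose c hc h using fun j : Fin (p + 1) =>
    abs_dotProduct_mulVec_le_add ((S.Ahat P)ᵀ * S.previewWeight P j)
  have hnn : ∀ (n : ℕ) (y : Fin n → ℝ), 0 ≤ y ⬝ᵥ y := fun n y =>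
    Finset.sum_nonneg fun i _ => mul_self_nonneg _
  have hcs : 0 ≤ ∑ j, c j := Finset.sum_nonneg fun j _ => hc j
  refine ⟨2 * c₀ + 2 * ∑ j, c j, by positivity, fun x b => ?_⟩
  have hbs : 0 ≤ ∑ j, b j ⬝ᵥ b j := Finset.sum_nonneg fun j _ => hnn _ _
  have h1 : S.costToGo P x b = x ⬝ᵥ (P *ᵥ x) +
      2 * ∑ j : Fin (p + 1), x ⬝ᵥ (((S.Ahat P)ᵀ * S.previewWeight P j) *ᵥ b j) := by
    unfold costToGo previewSum
    simp only [mulVec_sum, dotProduct_sum, mulVec_mulVec]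
  have h2 : |∑ j : Fin (p + 1), x ⬝ᵥ (((S.Ahat P)ᵀ * S.previewWeight P j) *ᵥ b j)| ≤
      (∑ j, c j) * (x ⬝ᵥ x + ∑ j, b j ⬝ᵥ b j) := by
    rw [Finset.sum_mul]
    refine (Finset.abs_sum_le_sum_abs _ _).trans (Finset.sum_le_sum fun j _ => ?_)
    refine (h j x (b j)).trans (mul_le_mul_of_nonneg_left ?_ (hc j))
    have := Finset.single_le_sum (f := fun j => b j ⬝ᵥ b j) (fun j _ => hnn _ _)
      (Finset.mem_univ j)
    linarith
  have h3 : |x ⬝ᵥ (P *ᵥ x)| ≤ 2 * c₀ * (x ⬝ᵥ x + ∑ j, b j ⬝ᵥ b j) := by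
    nlinarith [h₀ x x, mul_nonneg hc₀ hbs]
  rw [h1]
  calc _ ≤ |x ⬝ᵥ (P *ᵥ x)| + 2 * |∑ j : Fin (p + 1), x ⬝ᵥ (((S.Ahat P)ᵀ * S.previewWeight P j) *ᵥ b j)| := by
        refine (abs_add_le _ _).trans (add_le_add_right (le_of_eq ?_) _)
        rw [abs_mul, abs_two]
    _ ≤ _ := by linarith

section Averages

variable {Ω : Type*} [MeasurableSpace Ω] {μ : Measure Ω} {nx nu nw p : ℕ}
  {S : LQRData nx nu nw} {K : Policy nx nu nw p} {w : ℕ → Ω → Fin nw → ℝ} {x₀ : Ω → Fin nx → ℝ}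
  {x : ℕ → Ω → Fin nx → ℝ} {u : ℕ → Ω → Fin nu → ℝ} {P : Matrix (Fin nx) (Fin nx) ℝ}

theorem integrable_dotProduct_self {n : ℕ} {f : Ω → Fin n → ℝ} (hf : MemLp f 2 μ) :
    Integrable (fun ω => f ω ⬝ᵥ f ω) μ := by
  simpa using integrable_dotProduct_mulVec hf hf 1

theorem le_limsup_of_tendsto_comp {f g : ℕ → ℝ≥0∞} {l : ℝ≥0∞} {φ : ℕ → ℕ}
    (hφ : Tendsto φ atTop atTop) (hg : Tendsto g atTop (𝓝 l)) (h : ∀ n, g n ≤ f (φ n)) :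
    l ≤ limsup f atTop := by
  rw [← hg.limsup_eq]
  calc limsup g atTop ≤ limsup (f ∘ φ) atTop := limsup_le_limsup (Eventually.of_forall h)
    _ = limsup f (map φ atTop) := rfl
    _ ≤ limsup f atTop := limsup_le_limsup_of_le hφ

theorem ae_tendsto_costToGo_div (hw : IsNoise μ w) (hx : IsStabilized μ x) (d : ℕ)
    (S : LQRData nx nu nw) (P : Matrix (Fin nx) (Fin nx) ℝ) :
    ∀ᵐ ω ∂μ, Tendsto (fun n : ℕ => S.costToGo P (x (d * n ^ 2) ω)
      (LQRData.window p (fun t => w t ω) (d * n ^ 2)) / ((d * n ^ 2 : ℕ) : ℝ)) atTop (𝓝 0) := by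
  obtain ⟨C, hC⟩ := hx
  obtain ⟨c, hc, hle⟩ := S.abs_costToGo_le (p := p) P
  refine ae_tendsto_div_of_integral_le (C := c * (C + (p + 1 : ℕ) * nw))
    (g := fun T ω => S.costToGo P (x T ω) (LQRData.window p (fun t => w t ω) T))
    (fun T => ?_) (fun T => ?_) d
  · have h1 : ∀ ω, S.costToGo P (x T ω) (LQRData.window p (fun t => w t ω) T) =
        x T ω ⬝ᵥ (P *ᵥ x T ω) +
        2 * ∑ j : Fin (p + 1), x T ω ⬝ᵥ (((S.Ahat P)ᵀ * S.previewWeight P j) *ᵥ w (T + j) ω) := by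
      intro ω
      unfold LQRData.costToGo LQRData.previewSum
      simp only [mulVec_sum, dotProduct_sum, mulVec_mulVec, LQRData.window]
    simp_rw [h1]
    exact (integrable_dotProduct_mulVec (hC T).1 (hC T).1 _).add
      ((integrable_finsetSum _ fun j _ =>
        integrable_dotProduct_mulVec (hC T).1 (hw.memLp _) _).const_mul 2)
  · have hi1 := integrable_dotProduct_self (hC T).1
    have hi2 : ∀ j : Fin (p + 1), Integrable (fun ω => w (T + j) ω ⬝ᵥ w (T + j) ω) μ := fun j =>
      integrable_dotProduct_self (hw.memLp _)
    have hi3 := integrable_finsetSum Finset.univ fun j _ => hi2 j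
    calc ∫ ω, |S.costToGo P (x T ω) (LQRData.window p (fun t => w t ω) T)| ∂μ
        ≤ ∫ ω, c * (x T ω ⬝ᵥ x T ω + ∑ j : Fin (p + 1), w (T + j) ω ⬝ᵥ w (T + j) ω) ∂μ :=
          integral_mono_of_nonneg (Eventually.of_forall fun ω => abs_nonneg _)
            ((hi1.add hi3).const_mul c) (Eventually.of_forall fun ω => hle _ _)
      _ = c * (∫ ω, x T ω ⬝ᵥ x T ω ∂μ + (p + 1 : ℕ) * nw) := by
          rw [integral_const_mul, integral_add hi1 hi3, integral_finsetSum _ fun j _ => hi2 j]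
          simp_rw [hw.integral_dotProduct_self]
          simp
      _ ≤ _ := by
          have := (hC T).2.2
          gcongr

variable [IsProbabilityMeasure μ]

theorem IsClosedLoop.ae_tendsto_average_mul_noise (h : IsClosedLoop S K μ w x₀ x u)
    (hw : IsNoise μ w) (h0 : IsInitial μ w x₀) (hx : IsStabilized μ x) (d : ℕ) (a : Fin nx)
    (b : Fin nw) :
    ∀ᵐ ω ∂μ, Tendsto (fun n : ℕ => (∑ t ∈ Finset.range (d * n ^ 2),
      x (t + 1) ω a * w (t + 1 + p) ω b) / ((d * n ^ 2 : ℕ) : ℝ)) atTop (𝓝 0) := by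
  obtain ⟨C, hC⟩ := hx
  have hmx : ∀ t, Measurable fun ω => x t ω a := fun t =>
    (measurable_pi_apply a).comp (h.measurable_x hw h0 t)
  have hmw : ∀ t, Measurable fun ω => w t ω b := fun t =>
    (measurable_pi_apply b).comp (hw.measurable t)
  have hxa : ∀ t, MemLp (fun ω => x t ω a) 2 μ := fun t => (hC t).1.eval a
  have hmb : Measurable fun q : Fin nw → ℝ => q b := measurable_pi_apply b
  let next : ∀ t, Info nx nw p t × (Fin nu → ℝ) → Fin nx → ℝ := fun t q =>
    S.A *ᵥ q.1.1 (Fin.last t) + S.Bu *ᵥ q.2 + S.Bw *ᵥ q.1.2 ⟨t, by omega⟩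
  have hnext : ∀ t, Measurable fun q => next t q a := fun t => by
    refine Continuous.measurable ?_
    fun_prop
  have hnexteq : ∀ t ω, next t (info p x w t ω, u t ω) = x (t + 1) ω := fun t ω => by
    simp [next, info, h.step]
  have hind : ∀ t, IndepFun (fun ω => x (t + 1) ω a) (fun ω => w (t + 1 + p) ω b) μ := by
    intro t
    refine ((h.indepFun_info_action hw h0 t).comp (hnext t) hmb).congr
      (Eventually.of_forall fun ω => ?_) (Eventually.of_forall fun ω => rfl)
    simp only [Function.comp, hnexteq]
  have hind2 : ∀ s t, s < t → IndepFun
      (fun ω => x (s + 1) ω a * w (s + 1 + p) ω b * x (t + 1) ω a)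
      (fun ω => w (t + 1 + p) ω b) μ := by
    intro s t hst
    have hm : Measurable fun q : Info nx nw p t × (Fin nu → ℝ) =>
        q.1.1 ⟨s + 1, by omega⟩ a * q.1.2 ⟨s + 1 + p, by omega⟩ b * next t q a :=
      Measurable.mul (by fun_prop) (hnext t)
    refine ((h.indepFun_info_action hw h0 t).comp hm hmb).congr
      (Eventually.of_forall fun ω => ?_) (Eventually.of_forall fun ω => rfl)
    simp only [Function.comp, hnexteq]
    rfl
  have hsqind : ∀ t, IndepFun (fun ω => x (t + 1) ω a ^ 2) (fun ω => w (t + 1 + p) ω b ^ 2) μ :=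
    fun t => (hind t).comp (measurable_id.pow_const 2) (measurable_id.pow_const 2)
  have hwb : ∀ t, ∫ ω, w t ω b ^ 2 ∂μ = 1 := fun t => by
    have := hw.covariance t t b b
    simpa [sq] using this
  have hw0 : ∀ t, ∫ ω, w t ω b ∂μ = 0 := fun t => by
    have h1 := congrFun (hw.mean t) b
    rwa [eval_integral fun i => ((hw.memLp t).eval i).integrable one_le_two] at h1
  refine ae_tendsto_average_of_orthogonal (C := C)
    (z := fun t ω => x (t + 1) ω a * w (t + 1 + p) ω b) (fun t => ?_) (fun t => ?_) ?_ d
  · refine (memLp_two_iff_integrable_sq ((hmx _).mul (hmw _)).aestronglyMeasurable).2 ?_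
    simp only [Pi.mul_apply, mul_pow]
    exact (hsqind t).integrable_mul (hxa _).integrable_sq (hw.memLp_apply _ b).integrable_sq
  · simp_rw [mul_pow]
    have h1 := (hsqind t).integral_mul_eq_mul_integral
      ((hmx _).pow_const 2).aestronglyMeasurable ((hmw _).pow_const 2).aestronglyMeasurable
    simp only [Pi.mul_def] at h1
    rw [h1, hwb, mul_one]
    refine le_trans ?_ (hC (t + 1)).2.2
    refine integral_mono (hxa _).integrable_sq (integrable_dotProduct_self (hC _).1) fun ω => ?_
    simp only [sq]
    exact Finset.single_le_sum (f := fun i => x (t + 1) ω i * x (t + 1) ω i)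
      (fun i _ => mul_self_nonneg _) (Finset.mem_univ a)
  · intro s t hst
    have h1 := (hind2 s t hst).integral_mul_eq_mul_integral
      (((hmx _).mul (hmw _)).mul (hmx _)).aestronglyMeasurable (hmw _).aestronglyMeasurable
    simp only [Pi.mul_def] at h1
    rw [hw0, mul_zero] at h1
    simpa only [mul_assoc] using h1

theorem IsClosedLoop.ae_tendsto_average_dotProduct_noise (h : IsClosedLoop S K μ w x₀ x u)
    (hw : IsNoise μ w) (h0 : IsInitial μ w x₀) (hx : IsStabilized μ x) (d : ℕ)
    (D : Matrix (Fin nx) (Fin nw) ℝ) :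
    ∀ᵐ ω ∂μ, Tendsto (fun n : ℕ => (∑ t ∈ Finset.range (d * n ^ 2),
      x (t + 1) ω ⬝ᵥ (D *ᵥ w (t + 1 + p) ω)) / ((d * n ^ 2 : ℕ) : ℝ)) atTop (𝓝 0) := by
  have h1 := ae_all_iff.2 fun a => ae_all_iff.2 fun b =>
    h.ae_tendsto_average_mul_noise hw h0 hx d a b
  filter_upwards [h1] with ω hω
  have h2 := tendsto_finsetSum Finset.univ fun a _ => tendsto_finsetSum Finset.univ fun b _ =>
    (hω a b).const_mul (D a b)
  simp only [mul_zero, Finset.sum_const_zero] at h2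
  refine h2.congr fun n => ?_
  simp only [dotProduct, mulVec, Finset.mul_sum, Finset.sum_div]
  symm
  rw [Finset.sum_comm]
  refine Finset.sum_congr rfl fun a _ => ?_
  rw [Finset.sum_comm]
  refine Finset.sum_congr rfl fun b _ => Finset.sum_congr rfl fun t _ => ?_
  ring

/-- Along the times `(p + 1) * n ^ 2`, the average cost minus the average of the (nonnegative)
penalties for deviating from the preview law tends to the optimal value. -/
theorem IsClosedLoop.ae_tendsto_averageCost_sub (h : IsClosedLoop S K μ w x₀ x u)
    (hw : IsNoise μ w) (h0 : IsInitial μ w x₀) (hx : IsStabilized μ x) (hR : S.R.PosDef)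
    (hP : S.IsStabilizingSolution P) :
    ∀ᵐ ω ∂μ, Tendsto (fun n : ℕ => averageCost S x u ((p + 1) * n ^ 2) ω -
      (∑ t ∈ Finset.range ((p + 1) * n ^ 2),
        (u t ω - S.previewAction P (x t ω) (LQRData.window p (fun t => w t ω) t)) ⬝ᵥ
        (S.H P *ᵥ (u t ω - S.previewAction P (x t ω) (LQRData.window p (fun t => w t ω) t)))) /
      (((p + 1) * n ^ 2 : ℕ) : ℝ)) atTop (𝓝 (S.optimalValue P p)) := by
  have hsq : Tendsto (fun n : ℕ => n ^ 2) atTop atTop := tendsto_pow_atTop two_ne_zero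
  have hN : Tendsto (fun n : ℕ => (((p + 1) * n ^ 2 : ℕ) : ℝ)) atTop atTop :=
    tendsto_natCast_atTop_atTop.comp (tendsto_id.const_mul_atTop' (Nat.succ_pos p) |>.comp hsq)
  filter_upwards [ae_tendsto_costToGo_div hw hx (p + 1) S P (p := p),
    h.ae_tendsto_average_dotProduct_noise hw h0 hx (p + 1) (S.previewWeight P (p + 1)),
    ae_tendsto_average_window hw.measurable hw.indep hw.identDistrib
      (S.measurable_windowCost P p) (S.integrable_windowCost P hw)
      (S.integral_windowCost (PosSemidef.transpose_eq hP.posSemidef) hw)] with ω h1 h2 h3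
  have h4 : Tendsto (fun n : ℕ => S.costToGo P (x 0 ω) (LQRData.window p (fun t => w t ω) 0) /
      (((p + 1) * n ^ 2 : ℕ) : ℝ)) atTop (𝓝 0) := tendsto_const_nhds.div_atTop hN
  have h5 := (((h4.sub h1).add (h3.comp hsq)).add (h2.const_mul 2))
  simp only [sub_zero, zero_add, mul_zero, add_zero] at h5
  refine h5.congr fun n => ?_
  rw [averageCost, LQRData.sum_stageCost_eq hR hP.posSemidef hP.riccati_eq (p := p)
    (x := fun t => x t ω) (u := fun t => u t ω) (w := fun t => w t ω) fun t => h.step t ω]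
  simp only [Function.comp]
  ring

theorem IsClosedLoop.le_costInf (h : IsClosedLoop S K μ w x₀ x u)
    (hw : IsNoise μ w) (h0 : IsInitial μ w x₀) (hx : IsStabilized μ x) (hR : S.R.PosDef)
    (hP : S.IsStabilizingSolution P) :
    ∀ᵐ ω ∂μ, ENNReal.ofReal (S.optimalValue P p) ≤ costInf S x u ω := by
  filter_upwards [h.ae_tendsto_averageCost_sub hw h0 hx hR hP] with ω hω
  have h1 := (ENNReal.continuous_ofReal.tendsto _).comp hω
  have hsq : Tendsto (fun n : ℕ => (p + 1) * n ^ 2) atTop atTop :=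
    tendsto_id.const_mul_atTop' (Nat.succ_pos p) |>.comp (tendsto_pow_atTop two_ne_zero)
  refine le_limsup_of_tendsto_comp hsq h1 fun n => ENNReal.ofReal_le_ofReal ?_
  refine sub_le_self _ (div_nonneg (Finset.sum_nonneg fun t _ => ?_) (Nat.cast_nonneg _))
  exact PosSemidef.dotProduct_nonneg (LQRData.posDef_H hR hP.posSemidef).posSemidef _

end Averages

/-! ### The preview policy -/

section PreviewPolicy

theorem previewLaw_infoOfHistory_history {Ω : Type*} {nx nu nw : ℕ} (S : LQRData nx nu nw)
    (P : Matrix (Fin nx) (Fin nx) ℝ) (p t : ℕ) (x : ℕ → Ω → Fin nx → ℝ)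
    (w : ℕ → Ω → Fin nw → ℝ) (u : ℕ → Ω → Fin nu → ℝ) (ω : Ω) :
    previewLaw S P p t (infoOfHistory nx nu nw p t (history x w u t ω)) =
      S.previewAction P (x t ω) (LQRData.window p (fun t => w t ω) t) :=
  previewLaw_eq S P p t (fun t => x t ω) (fun t => w t ω)

variable {Ω : Type*} [MeasurableSpace Ω] {μ : Measure Ω} {nx nu nw p : ℕ}
  {S : LQRData nx nu nw} {w : ℕ → Ω → Fin nw → ℝ} {x₀ : Ω → Fin nx → ℝ}
  {x : ℕ → Ω → Fin nx → ℝ} {u : ℕ → Ω → Fin nu → ℝ} {P : Matrix (Fin nx) (Fin nx) ℝ}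

theorem comap_kernel_previewPolicy (S : LQRData nx nu nw) (P : Matrix (Fin nx) (Fin nx) ℝ)
    (p t : ℕ) : ((previewPolicy S P p).kernel t).comap (infoOfHistory nx nu nw p t)
      (measurable_infoOfHistory nx nu nw p t) =
    Kernel.deterministic (previewLaw S P p t ∘ infoOfHistory nx nu nw p t)
      ((measurable_previewLaw S P p t).comp (measurable_infoOfHistory nx nu nw p t)) := by
  ext1 q
  simp [previewPolicy, Policy.deterministic, Kernel.comap_apply, Kernel.deterministic_apply]

/-- A variable whose conditional law is a point mass is a function of what it is conditioned on. -/
theorem ae_eq_of_hasCondDistrib_deterministic [IsFiniteMeasure μ] {α : Type*} {n : ℕ}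
    [MeasurableSpace α] {X : Ω → α} {Y : Ω → Fin n → ℝ} {f : α → Fin n → ℝ} (hf : Measurable f)
    (h : HasCondDistrib Y X (Kernel.deterministic f hf) μ) : ∀ᵐ ω ∂μ, Y ω = f (X ω) := by
  have h1 := h.map_eq
  rw [Measure.compProd_deterministic hf] at h1
  have hs : MeasurableSet {q : α × (Fin n → ℝ) | q.2 = f q.1} :=
    measurableSet_eq_fun measurable_snd (hf.comp measurable_fst)
  have h2 : ∀ᵐ q ∂((μ.map X).map fun a => (a, f a)), q.2 = f q.1 := by
    have hm : Measurable fun a => (a, f a) := measurable_id.prodMk hf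
    rw [ae_map_iff hm.aemeasurable hs]
    exact Eventually.of_forall fun a => rfl
  rw [← h1, ae_map_iff h.aemeasurable hs] at h2
  exact h2

theorem hasCondDistrib_deterministic [IsFiniteMeasure μ] {α β : Type*} [MeasurableSpace α]
    [MeasurableSpace β] {X : Ω → α} (hX : Measurable X) {f : α → β} (hf : Measurable f) :
    HasCondDistrib (fun ω => f (X ω)) X (Kernel.deterministic f hf) μ where
  aemeasurable := (hX.prodMk (hf.comp hX)).aemeasurable
  map_eq := by
    have hm : Measurable fun a => (a, f a) := measurable_id.prodMk hf
    rw [Measure.compProd_deterministic hf, Measure.map_map hm hX]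
    rfl

theorem IsClosedLoop.ae_eq_previewAction [IsProbabilityMeasure μ]
    (h : IsClosedLoop S (previewPolicy S P p) μ w x₀ x u) : ∀ᵐ ω ∂μ, ∀ t,
      u t ω = S.previewAction P (x t ω) (LQRData.window p (fun t => w t ω) t) := by
  refine ae_all_iff.2 fun t => ?_
  have h1 := h.law t
  rw [comap_kernel_previewPolicy] at h1
  filter_upwards [ae_eq_of_hasCondDistrib_deterministic _ h1] with ω hω
  rw [hω, Function.comp, previewLaw_infoOfHistory_history]

/-- The state of the closed loop with the preview law. -/
noncomputable def previewState (S : LQRData nx nu nw) (P : Matrix (Fin nx) (Fin nx) ℝ) (p : ℕ)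
    (w : ℕ → Ω → Fin nw → ℝ) (x₀ : Ω → Fin nx → ℝ) : ℕ → Ω → Fin nx → ℝ
  | 0 => x₀
  | t + 1 => fun ω => S.A *ᵥ previewState S P p w x₀ t ω +
      S.Bu *ᵥ S.previewAction P (previewState S P p w x₀ t ω)
        (LQRData.window p (fun t => w t ω) t) + S.Bw *ᵥ w t ω

theorem LQRData.continuous_previewAction (S : LQRData nx nu nw)
    (P : Matrix (Fin nx) (Fin nx) ℝ) : Continuous
      fun q : (Fin nx → ℝ) × (Fin (p + 1) → Fin nw → ℝ) => S.previewAction P q.1 q.2 := by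
  unfold LQRData.previewAction LQRData.previewTail
  fun_prop

theorem measurable_previewAction_window (S : LQRData nx nu nw) (P : Matrix (Fin nx) (Fin nx) ℝ)
    (hw : ∀ t, Measurable (w t)) {y : Ω → Fin nx → ℝ} (hy : Measurable y) (t : ℕ) :
    Measurable fun ω => S.previewAction P (y ω) (LQRData.window p (fun t => w t ω) t) := by
  have h1 : Measurable fun ω => LQRData.window p (fun t => w t ω) t :=
    measurable_pi_lambda _ fun j => hw _
  have h2 : Measurable fun q : (Fin nx → ℝ) × (Fin (p + 1) → Fin nw → ℝ) =>
      S.previewAction P q.1 q.2 := (S.continuous_previewAction P).measurable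
  exact Measurable.comp
    (g := fun q : (Fin nx → ℝ) × (Fin (p + 1) → Fin nw → ℝ) => S.previewAction P q.1 q.2)
    (f := fun ω => (y ω, LQRData.window p (fun t => w t ω) t)) h2 (hy.prodMk h1)

theorem exists_isClosedLoop_previewPolicy [IsProbabilityMeasure μ] (S : LQRData nx nu nw)
    (P : Matrix (Fin nx) (Fin nx) ℝ) (p : ℕ) (hw : IsNoise μ w) (h0 : IsInitial μ w x₀) :
    ∃ (x : ℕ → Ω → Fin nx → ℝ) (u : ℕ → Ω → Fin nu → ℝ),
      IsClosedLoop S (previewPolicy S P p) μ w x₀ x u := by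
  obtain ⟨x, hx0, hxs⟩ : ∃ x : ℕ → Ω → Fin nx → ℝ, x 0 = x₀ ∧ ∀ t, x (t + 1) = fun ω =>
      S.A *ᵥ x t ω + S.Bu *ᵥ S.previewAction P (x t ω) (LQRData.window p (fun t => w t ω) t) +
        S.Bw *ᵥ w t ω :=
    ⟨previewState S P p w x₀, rfl, fun t => rfl⟩
  obtain ⟨u, hu⟩ : ∃ u : ℕ → Ω → Fin nu → ℝ, ∀ t, u t = fun ω =>
      S.previewAction P (x t ω) (LQRData.window p (fun t => w t ω) t) := ⟨_, fun t => rfl⟩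
  have hmu : ∀ t, Measurable (x t) → Measurable (u t) := fun t hx => by
    rw [hu]
    exact measurable_previewAction_window S P hw.measurable hx t
  have hmx : ∀ t, Measurable (x t) := by
    intro t
    induction t with
    | zero => rw [hx0]; exact h0.measurable
    | succ t ih =>
      have h2 : Measurable fun q : (Fin nx → ℝ) × (Fin nu → ℝ) × (Fin nw → ℝ) =>
          S.A *ᵥ q.1 + S.Bu *ᵥ q.2.1 + S.Bw *ᵥ q.2.2 := by
        refine Continuous.measurable ?_
        fun_prop
      have h3 := h2.comp (ih.prodMk ((hmu t ih).prodMk (hw.measurable t)))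
      rw [hxs]
      rw [hu] at h3
      exact h3
  refine ⟨x, u, fun t => hmu t (hmx t), hx0, fun t ω => by rw [hxs, hu], fun t => ?_⟩
  have hh : Measurable (history x w u t) :=
    (measurable_pi_lambda _ fun s => hmx _).prodMk
      ((measurable_pi_lambda _ fun s => hw.measurable _).prodMk
        (measurable_pi_lambda _ fun s => hmu _ (hmx _)))
  rw [comap_kernel_previewPolicy]
  have h1 := hasCondDistrib_deterministic (μ := μ) hh
    ((measurable_previewLaw S P p t).comp (measurable_infoOfHistory nx nu nw p t))
  have h2 : (fun ω => (previewLaw S P p t ∘ infoOfHistory nx nu nw p t) (history x w u t ω)) =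
      u t := by
    rw [hu]
    exact funext fun ω => previewLaw_infoOfHistory_history S P p t x w u ω
  rwa [h2] at h1

theorem _root_.MeasureTheory.MemLp.mulVec {m n : ℕ} {f : Ω → Fin n → ℝ} {q : ℝ≥0∞}
    (hf : MemLp f q μ) (M : Matrix (Fin m) (Fin n) ℝ) : MemLp (fun ω => M *ᵥ f ω) q μ := by
  refine MemLp.of_eval fun i => ?_
  change MemLp (fun ω => ∑ j, M i j * f ω j) q μ
  exact memLp_finsetSum _ fun j _ => (hf.eval j).const_mul (M i j)

/-- The response of a Schur system to an initial state and an input, both bounded in `L²`, is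
bounded in `L²`. -/
theorem IsSchur.exists_lpNorm_le [IsProbabilityMeasure μ] {n : ℕ} {M : Matrix (Fin n) (Fin n) ℝ}
    (hM : IsSchur M) {x e : ℕ → Ω → Fin n → ℝ} (h0 : MemLp (x 0) 2 μ) (he : ∀ t, MemLp (e t) 2 μ)
    {E : ℝ} (hE : ∀ t, lpNorm (e t) 2 μ ≤ E)
    (hx : ∀ᵐ ω ∂μ, ∀ t, x (t + 1) ω = M *ᵥ x t ω + e t ω) :
    ∃ B, ∀ t, MemLp (x t) 2 μ ∧ lpNorm (x t) 2 μ ≤ B := by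
  obtain ⟨c, r, hc, hr, hr1, hpow⟩ := hM.exists_pow_mulVec_le
  have hE0 : 0 ≤ E := lpNorm_nonneg.trans (hE 0)
  have hpowLp : ∀ (k : ℕ) {f : Ω → Fin n → ℝ}, MemLp f 2 μ →
      lpNorm (fun ω => M ^ k *ᵥ f ω) 2 μ ≤ c * r ^ k * lpNorm f 2 μ := by
    intro k f hf
    refine (lpNorm_mono_real (hf.norm.const_mul (c * r ^ k)) fun ω => hpow k (f ω)).trans
      (le_of_eq ?_)
    have h1 := lpNorm_const_smul (p := 2) (c * r ^ k) (fun ω => ‖f ω‖) μ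
    have h2 : lpNorm (fun ω => ‖f ω‖) 2 μ = lpNorm f 2 μ := lpNorm_norm hf.aestronglyMeasurable 2
    rw [h2, Real.nnnorm_of_nonneg (by positivity)] at h1
    exact h1
  have hsol : ∀ᵐ ω ∂μ, ∀ t, x t ω =
      M ^ t *ᵥ x 0 ω + ∑ s ∈ Finset.range t, M ^ (t - 1 - s) *ᵥ e s ω := by
    filter_upwards [hx] with ω hω t
    induction t with
    | zero => simp
    | succ t ih =>
      rw [hω, ih, Finset.sum_range_succ, mulVec_add, mulVec_mulVec, ← pow_succ', mulVec_sum,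
        ← add_assoc]
      congr 2
      · refine Finset.sum_congr rfl fun s hs => ?_
        have := Finset.mem_range.1 hs
        rw [mulVec_mulVec, ← pow_succ', show t - 1 - s + 1 = t + 1 - 1 - s by omega]
      · simp
  have hm1 : ∀ t, MemLp (fun ω => M ^ t *ᵥ x 0 ω) 2 μ := fun t => h0.mulVec _
  have hm2 : ∀ t s, MemLp (fun ω => M ^ (t - 1 - s) *ᵥ e s ω) 2 μ := fun t s => (he s).mulVec _
  have hm3 : ∀ t, MemLp (∑ s ∈ Finset.range t, fun ω => M ^ (t - 1 - s) *ᵥ e s ω) 2 μ := fun t =>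
    memLp_finsetSum' _ fun s _ => hm2 t s
  have hae : ∀ t, x t =ᵐ[μ] (fun ω => M ^ t *ᵥ x 0 ω) +
      ∑ s ∈ Finset.range t, fun ω => M ^ (t - 1 - s) *ᵥ e s ω := fun t => by
    filter_upwards [hsol] with ω hω
    rw [hω t, Pi.add_apply, Finset.sum_apply]
  refine ⟨c * lpNorm (x 0) 2 μ + c * (1 - r)⁻¹ * E, fun t => ?_⟩
  have hmem := ((hm1 t).add (hm3 t)).ae_eq (hae t).symm
  refine ⟨hmem, ?_⟩
  have hcongr : lpNorm (x t) 2 μ = lpNorm ((fun ω => M ^ t *ᵥ x 0 ω) +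
      ∑ s ∈ Finset.range t, fun ω => M ^ (t - 1 - s) *ᵥ e s ω) 2 μ := by
    rw [← toReal_eLpNorm hmem.aestronglyMeasurable,
      ← toReal_eLpNorm ((hm1 t).add (hm3 t)).aestronglyMeasurable, eLpNorm_congr_ae (hae t)]
  have h12 : (1 : ℝ≥0∞) ≤ 2 := one_le_two
  rw [hcongr]
  refine (lpNorm_add_le (hm1 t) h12).trans (add_le_add ?_ ?_)
  · refine (hpowLp t h0).trans ?_
    have : r ^ t ≤ 1 := pow_le_one₀ hr hr1.le
    calc c * r ^ t * lpNorm (x 0) 2 μ ≤ c * 1 * lpNorm (x 0) 2 μ := by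
          gcongr
          exact lpNorm_nonneg
      _ = _ := by ring
  · refine (lpNorm_sum_le (fun s _ => hm2 t s) h12).trans ?_
    calc ∑ s ∈ Finset.range t, lpNorm (fun ω => M ^ (t - 1 - s) *ᵥ e s ω) 2 μ
        ≤ ∑ s ∈ Finset.range t, c * r ^ (t - 1 - s) * E := by
          refine Finset.sum_le_sum fun s _ => (hpowLp _ (he s)).trans ?_
          gcongr
          exact hE s
      _ = c * (∑ s ∈ Finset.range t, r ^ s) * E := by
          rw [Finset.sum_range_reflect (fun s => c * r ^ s * E) t, Finset.mul_sum, Finset.sum_mul]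
      _ ≤ c * (1 - r)⁻¹ * E := by
          gcongr
          rw [← tsum_geometric_of_lt_one hr hr1]
          exact (summable_geometric_of_lt_one hr hr1).sum_le_tsum _ fun _ _ => by positivity

theorem isStabilized_of_lpNorm_le [IsProbabilityMeasure μ] {B : ℝ}
    (h : ∀ t, MemLp (x t) 2 μ ∧ lpNorm (x t) 2 μ ≤ B) : IsStabilized μ x := by
  have hB0 : 0 ≤ B := lpNorm_nonneg.trans (h 0).2
  have hint : ∀ t, Integrable (fun ω => ‖x t ω‖ ^ 2) μ := fun t => (h t).1.norm.integrable_sq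
  have hsq : ∀ t, ∫ ω, ‖x t ω‖ ^ 2 ∂μ ≤ B ^ 2 := by
    intro t
    have h1 := lpNorm_eq_integral_norm_rpow_toReal (p := 2) two_ne_zero ENNReal.ofNat_ne_top
      (h t).1.aestronglyMeasurable
    have h2 : lpNorm (x t) 2 μ ^ 2 = ∫ ω, ‖x t ω‖ ^ 2 ∂μ := by
      rw [h1]
      simp only [ENNReal.toReal_ofNat, Real.rpow_two]
      rw [← Real.rpow_natCast, ← Real.rpow_mul (integral_nonneg fun ω => by positivity)]
      norm_num
    rw [← h2]
    exact pow_le_pow_left₀ lpNorm_nonneg (h t).2 2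
  refine ⟨(nx + 1) * B ^ 2 + 1, fun t => ⟨(h t).1, ?_, ?_⟩⟩
  · calc ‖∫ ω, x t ω ∂μ‖ ≤ ∫ ω, ‖x t ω‖ ∂μ := norm_integral_le_integral_norm _
      _ ≤ ∫ ω, (‖x t ω‖ ^ 2 + 1) ∂μ := by
          refine integral_mono ((h t).1.integrable one_le_two).norm
            ((hint t).add (integrable_const 1)) fun ω => ?_
          nlinarith [sq_nonneg (‖x t ω‖ - 1), sq_nonneg ‖x t ω‖]
      _ = ∫ ω, ‖x t ω‖ ^ 2 ∂μ + 1 := by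
          rw [integral_add (hint t) (integrable_const 1)]
          simp
      _ ≤ _ := by nlinarith [hsq t, mul_nonneg (Nat.cast_nonneg (α := ℝ) nx) (sq_nonneg B)]
  · calc ∫ ω, x t ω ⬝ᵥ x t ω ∂μ ≤ ∫ ω, nx * ‖x t ω‖ ^ 2 ∂μ := by
          refine integral_mono (integrable_dotProduct_self (h t).1) ((hint t).const_mul _)
            fun ω => ?_
          have : ∀ i ∈ Finset.univ, x t ω i * x t ω i ≤ ‖x t ω‖ ^ 2 := fun i _ => by
            rw [← sq, ← sq_abs]
            exact pow_le_pow_left₀ (abs_nonneg _) (norm_le_pi_norm (x t ω) i) 2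
          simpa [dotProduct] using Finset.sum_le_sum this
      _ ≤ _ := by
          rw [integral_const_mul]
          nlinarith [hsq t, mul_le_mul_of_nonneg_left (hsq t) (Nat.cast_nonneg (α := ℝ) nx),
            sq_nonneg B]

variable [IsProbabilityMeasure μ]

theorem IsClosedLoop.isStabilized_previewPolicy
    (h : IsClosedLoop S (previewPolicy S P p) μ w x₀ x u) (hw : IsNoise μ w)
    (h0 : IsInitial μ w x₀) (hP : IsSchur (S.Ahat P)) : IsStabilized μ x := by
  let g : (Fin (p + 1) → Fin nw → ℝ) → Fin nx → ℝ := fun b =>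
    S.Bu *ᵥ S.previewAction P 0 b + S.Bw *ᵥ b 0
  have hg : Measurable g := by
    have h1 := (S.continuous_previewAction P (p := p)).comp (continuous_const (y := 0) |>.prodMk
      continuous_id)
    refine Continuous.measurable ?_
    exact (Continuous.matrix_mulVec continuous_const h1).add
      (Continuous.matrix_mulVec continuous_const (continuous_apply 0))
  set e : ℕ → Ω → Fin nx → ℝ := fun t ω => g (LQRData.window p (fun t => w t ω) t) with hedef
  have he : ∀ t, MemLp (e t) 2 μ := by
    intro t
    simp only [hedef, g, LQRData.previewAction, LQRData.previewTail, LQRData.window]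
    refine MemLp.add (MemLp.mulVec (MemLp.sub (MemLp.sub ?_ ?_) ?_) _) ((hw.memLp _).mulVec _)
    · simp
    · exact (hw.memLp _).mulVec _
    · exact (memLp_finsetSum _ fun j _ => (hw.memLp _).mulVec _).mulVec _
  have hE : ∀ t, lpNorm (e t) 2 μ ≤ lpNorm (e 0) 2 μ := by
    intro t
    rw [← toReal_eLpNorm (he t).aestronglyMeasurable, ← toReal_eLpNorm (he 0).aestronglyMeasurable]
    exact (congrArg ENNReal.toReal (((identDistrib_window hw.measurable hw.indep hw.identDistrib
      p t 0).comp hg).eLpNorm_eq 2)).le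
  obtain ⟨B, hB⟩ := hP.exists_lpNorm_le (x := x) (by rw [h.init]; exact h0.memLp) he hE (by
    filter_upwards [h.ae_eq_previewAction] with ω hω t
    rw [h.step, hω]
    simp only [hedef, g, LQRData.previewAction, LQRData.Ahat, mulVec_sub, mulVec_neg, sub_mulVec,
      mulVec_mulVec, mulVec_zero, LQRData.window, Fin.val_zero, add_zero]
    abel)
  exact isStabilized_of_lpNorm_le hB

theorem IsClosedLoop.ae_tendsto_averageCost_previewPolicy
    (h : IsClosedLoop S (previewPolicy S P p) μ w x₀ x u) (hw : IsNoise μ w)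
    (h0 : IsInitial μ w x₀) (hQ : S.Q.PosSemidef) (hR : S.R.PosDef)
    (hP : S.IsStabilizingSolution P) :
    ∀ᵐ ω ∂μ, Tendsto (fun T => averageCost S x u T ω) atTop (𝓝 (S.optimalValue P p)) := by
  filter_upwards [h.ae_tendsto_averageCost_sub hw h0
    (h.isStabilized_previewPolicy hw h0 hP.schur) hR hP, h.ae_eq_previewAction] with ω h1 h2
  have havg : ∀ T, averageCost S x u T ω =
      (∑ t ∈ Finset.range T, S.stageCost (x t ω) (u t ω)) / T := fun T => by
    rw [averageCost]; ring
  simp only [h2, sub_self, zero_dotProduct, Finset.sum_const_zero, zero_div, sub_zero] at h1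
  simp only [havg] at h1 ⊢
  refine tendsto_div_of_monotone_of_exists_subseq_tendsto_div _ _ ?_ fun a ha =>
    ⟨fun n => (p + 1) * n ^ 2, ?_, ?_, h1⟩
  · refine monotone_nat_of_le_succ fun T => ?_
    rw [Finset.sum_range_succ]
    exact le_add_of_nonneg_right (LQRData.stageCost_nonneg hQ hR _ _)
  · filter_upwards [tendsto_natCast_atTop_atTop.eventually_ge_atTop (3 / (a - 1)),
      eventually_ge_atTop 1] with n hn hn1
    rw [div_le_iff₀ (by linarith)] at hn
    have hn1' : (1 : ℝ) ≤ n := by exact_mod_cast hn1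
    push_cast
    have h3 : ((n : ℝ) + 1) ^ 2 ≤ a * (n : ℝ) ^ 2 := by nlinarith
    calc ((p : ℝ) + 1) * ((n : ℝ) + 1) ^ 2 ≤ ((p : ℝ) + 1) * (a * (n : ℝ) ^ 2) := by gcongr
      _ = _ := by ring
  · exact tendsto_id.const_mul_atTop' (Nat.succ_pos p) |>.comp (tendsto_pow_atTop two_ne_zero)

theorem IsClosedLoop.expectedCost_eq_of_ae_eq {K : Policy nx nu nw p}
    (h : IsClosedLoop S K μ w x₀ x u) (hw : IsNoise μ w) (h0 : IsInitial μ w x₀) {c : ℝ≥0∞}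
    (hc : ∀ᵐ ω ∂μ, costInf S x u ω = c) : ∀ᵐ ω ∂μ, expectedCost S p μ w x u ω = c := by
  have hm := (h.measurable_info hw h0 0).comap_le
  have h1 : costInf S x u =ᵐ[μ] fun _ => c := hc
  have h2 := condLExp_congr_ae (mΩ := MeasurableSpace.comap (info p x w 0) inferInstance) h1
  rw [condLExp_const hm] at h2
  exact h2

theorem IsClosedLoop.le_expectedCost_of_ae_le {K : Policy nx nu nw p}
    (h : IsClosedLoop S K μ w x₀ x u) (hw : IsNoise μ w) (h0 : IsInitial μ w x₀) {c : ℝ≥0∞}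
    (hc : ∀ᵐ ω ∂μ, c ≤ costInf S x u ω) : ∀ᵐ ω ∂μ, c ≤ expectedCost S p μ w x u ω := by
  have hm := (h.measurable_info hw h0 0).comap_le
  have h1 : (fun _ => c) ≤ᵐ[μ] costInf S x u := hc
  have h2 := condLExp_mono (mΩ := MeasurableSpace.comap (info p x w 0) inferInstance) h1
  rw [condLExp_const hm] at h2
  exact h2

end PreviewPolicy

end PreviewLQR

theorem mainTheorem1 {nx nu nw : ℕ} (S : LQRData nx nu nw) (p : ℕ)
    (hA : IsUnit S.A) (hAB : Stabilizable S.A S.Bu)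
    (hQ : S.Q.PosSemidef) (hR : S.R.PosDef) (hAQ : Detectable S.A S.Q) :
    ∃ P : Matrix (Fin nx) (Fin nx) ℝ,
      S.IsStabilizingSolution P ∧
      (∀ P' : Matrix (Fin nx) (Fin nx) ℝ, S.IsStabilizingSolution P' → P' = P) ∧
      ∀ (Ω : Type*) [MeasurableSpace Ω] (μ : Measure Ω) [IsProbabilityMeasure μ]
        (w : ℕ → Ω → Fin nw → ℝ) (x₀ : Ω → Fin nx → ℝ),
        IsNoise μ w → IsInitial μ w x₀ →
        -- the deterministic preview policy can be run, it is stabilizing, the limit that defines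
        -- its average cost exists almost surely, and its expected cost given `i_0` is the constant
        (∃ (x : ℕ → Ω → Fin nx → ℝ) (u : ℕ → Ω → Fin nu → ℝ),
          IsClosedLoop S (previewPolicy S P p) μ w x₀ x u) ∧
        (∀ (x : ℕ → Ω → Fin nx → ℝ) (u : ℕ → Ω → Fin nu → ℝ),
          IsClosedLoop S (previewPolicy S P p) μ w x₀ x u →
            IsStabilized μ x ∧
            (∀ᵐ ω ∂μ, Tendsto (fun T => averageCost S x u T ω) atTop
              (𝓝 (S.optimalValue P p))) ∧
            ∀ᵐ ω ∂μ, expectedCost S p μ w x u ω = ENNReal.ofReal (S.optimalValue P p)) ∧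
        -- no stabilizing policy does better
        (∀ (K : Policy nx nu nw p) (x : ℕ → Ω → Fin nx → ℝ) (u : ℕ → Ω → Fin nu → ℝ),
          IsClosedLoop S K μ w x₀ x u → IsStabilized μ x →
            ∀ᵐ ω ∂μ, ENNReal.ofReal (S.optimalValue P p) ≤ expectedCost S p μ w x u ω) := by
  obtain ⟨P, hP⟩ := LQRData.exists_isStabilizingSolution hAB hQ hR hAQ
  refine ⟨P, hP, fun P' hP' => hP.unique hQ hR hP', ?_⟩
  intro Ω _ μ _ w x₀ hw h0
  refine ⟨exists_isClosedLoop_previewPolicy S P p hw h0, fun x u h => ?_, fun K x u h hx => ?_⟩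
  · have hlim := h.ae_tendsto_averageCost_previewPolicy hw h0 hQ hR hP
    refine ⟨h.isStabilized_previewPolicy hw h0 hP.schur, hlim,
      h.expectedCost_eq_of_ae_eq hw h0 ?_⟩
    filter_upwards [hlim] with ω hω
    exact ((ENNReal.continuous_ofReal.tendsto _).comp hω).limsup_eq
  · exact h.le_expectedCost_of_ae_le hw h0 (h.le_costInf hw h0 hx hR hP)
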